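/- **Setting.** Let $n\ge 2$, $0<\kappa<1$, $0<c_1<c_2$, let $\Omega\subseteq S^{n-1}$ be (relatively) open, let $\Sigma\subseteq\mathbb R^n$, and put $\Gamma=\{rx: x\in\Omega,\ c_1\le r\le c_2\}$. For $X\neq 0$ write $\operatorname{dir}X=X/|X|$. For $x,Y,X_0\in\mathbb R^n$ let $$h(x,Y,X_0)=\frac{b-\kappa^2x\cdot Y-\sqrt{(b-\kappa^2x\cdot Y)^2-(1-\kappa^2)(b^2-\kappa^2|Y|^2)}}{1-\kappa^2},\qquad b=|X_0|+\kappa|X_0-Y|,$$ which for $|x|=1$ is the polar radius of the Descartes oval $\{X:|X|+\kappa|X-Y|=b\}$ through $X_0$. For $x_0,\bar m,\hat m\in S^{n-1}$ with $\bar m\cdot x_0,\hat m\cdot x_0\ge\kappa$ and $\lambda\in[0,1]$ let $m_\lambda=(1-\lambda)\bar m+\lambda\hat m$, $\xi=m_\lambda-x_0/\kappa$, $$\beta(\lambda)=\frac{-x_0\cdot\xi-\sqrt{(x_0\cdot\xi)^2-(1-\kappa^2)|\xi|^2}}{\kappa|\xi|^2},\qquad m(\lambda)=\frac{x_0}{\kappa}+\beta(\lambda)\,\xi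 ,$$ and $[\bar m,\hat m]_{x_0}=\{m(\lambda):0\le\lambda\le1\}$ (the intersection of $S^{n-1}$ with the triangle with vertices $\bar m,\hat m,x_0/\kappa$). **Hypotheses.** * **H.A** (a) $\operatorname{dir}X\cdot\operatorname{dir}(Y-X)\ge\kappa$ for all $X\in\Gamma$, $Y\in\Sigma$. (b) For each $X\in\Gamma$ there are a set $E(X)\subseteq\{m\in S^{n-1}:m\cdot\operatorname{dir}X\ge\kappa\}$ and a continuous $s_X:E(X)\to(0,\infty)$ with $\Sigma=\{X+s_X(m)m:m\in E(X)\}$ and $[\bar m,\hat m]_{\operatorname{dir}X}\subseteq E(X)$ for all $\bar m,\hat m\in E(X)$. (c) There is $C>0$ with $|s_X(m_1)-s_X(m_2)|\le C|m_1-m_2|$ for all $X\in\Gamma$ and $m_1,m_2\in E(X)$. * **H.B** $|X|/|Y-X|\le\kappa\left(\sqrt{1+(1+\kappa)^{-2}}-1\right)$ for all $X\in\Gamma$, $Y\in\Sigma$. * **H.C** There is $0\le\mu<\kappa$ such that for all $X_0\in\Gamma$, $\bar m,\hat m\in E(X_0)$ and $\lambda\in[0,1]$, with $x_0=\operatorname{dir}X_0$,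 $$\frac1{s_{X_0}(m(\lambda))}+\frac{\mu}{|X_0|}\ \ge\ (1-\lambda)\beta(\lambda)\Big(\frac1{s_{X_0}(\bar m)}+\frac{\mu}{|X_0|}\Big)+\lambda\beta(\lambda)\Big(\frac1{s_{X_0}(\hat m)}+\frac{\mu}{|X_0|}\Big).$$ * **H.D** There are $\mu_0>0$ and $C>0$ such that for all $X_0\in\Gamma$, $\bar Y,\hat Y\in\Sigma$ and $0<\mu\le\mu_0$, $$H^{n-1}\big(N_\mu(\{Y(\lambda):\tfrac14\le\lambda\le\tfrac34\})\cap\Sigma\big)\ge C\mu^{n-2}|\bar Y-\hat Y|,$$ where $Y(\lambda)=X_0+s_{X_0}(m(\lambda))m(\lambda)$ with $x_0=\operatorname{dir}X_0$, $\bar m=\operatorname{dir}(\bar Y-X_0)$, $\hat m=\operatorname{dir}(\hat Y-X_0)$, $N_\mu$ is the $\mu$-neighbourhood in $\mathbb R^n$ and $H^{n-1}$ is the $(n-1)$-dimensional Hausdorff measure. For $u:\Omega\to[c_1,c_2]$ and $x_0\in\Omega$ let $\partial u(x_0)$ be the set of $Y\in\Sigma$ such that $u(x)\ge h(x,Y,u(x_0)x_0)$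 for all $x\in\Omega$; $u$ is a *refractor from $\Omega$ to $\Sigma$* if $\partial u(x_0)\ne\emptyset$ for all $x_0\in\Omega$. **Theorem.** Assume H.A, H.B, H.C and H.D, and let $u$ be a refractor from $\Omega$ to $\Sigma$ for which there is a constant $C$ such that $H^{n-1}\big(\bigcup_{x\in B_\sigma\cap S^{n-1}}\partial u(x)\big)\le C\sigma^{n-1}$ for every ball $B_\sigma$ of radius $\sigma>0$ centred on $S^{n-1}$ with $B_\sigma\cap S^{n-1}\subseteq\Omega$. Then $u\in C^{1,\alpha}_{\rm loc}(\Omega)$ with $\alpha=\frac1{4n-5}$; that is, $\tilde u(X)=u(X/|X|)$ is differentiable at every point of $\Omega$, and for every compact $K\subseteq\Omega$ there is $C_K$ with $|\nabla\tilde u(\bar x)-\nabla\tilde u(\hat x)|\le C_K|\bar x-\hat x|^{\alpha}$ for all $\bar x,\hat x\in K$. Moreover, for every $x_0\in\Omega$ the set $\partial u(x_0)$ is a single point $Y$, the function $h(\cdot,Y,X_0)$ with $X_0=u(x_0)x_0$ is differentiable at $x_0$, and $$\nabla\tilde u(x_0)=\nabla h(x_0,Y,X_0)-\langle\nabla h(x_0,Y,X_0),x_0\rangle\,x_0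 .$$ -/

import Mathlib

open scoped RealInnerProductSpace MeasureTheory

noncomputable section

namespace NearField

/-- `ℝⁿ` with its Euclidean structure. -/
abbrev Space (n : ℕ) : Type := EuclideanSpace ℝ (Fin n)

/-- The unit sphere `S^{n-1}` of `ℝⁿ`. -/
abbrev unitSphere (n : ℕ) : Set (Space n) := Metric.sphere (0 : Space n) 1

/-- The direction `X / |X|`. -/
def dir {n : ℕ} (X : Space n) : Space n := ‖X‖⁻¹ • X

/-- The polar radius `ρ(x, Y, b)` of the Descartes oval `{X : |X| + κ |X - Y| = b}`. The same formula
is used for `x` off the unit sphere. -/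
def ovalRadius {n : ℕ} (κ : ℝ) (x Y : Space n) (b : ℝ) : ℝ :=
  (b - κ ^ 2 * ⟪x, Y⟫ -
      √((b - κ ^ 2 * ⟪x, Y⟫) ^ 2 - (1 - κ ^ 2) * (b ^ 2 - κ ^ 2 * ‖Y‖ ^ 2))) / (1 - κ ^ 2)

/-- `h(x, Y, X₀)`: polar radius of the oval with focus `Y` through the point `X₀`. -/
def h {n : ℕ} (κ : ℝ) (x Y X₀ : Space n) : ℝ :=
  ovalRadius κ x Y (‖X₀‖ + κ * ‖X₀ - Y‖)

/-- `Γ_{c₁c₂} = {r x : x ∈ Ω, c₁ ≤ r ≤ c₂}`. -/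
def Gam {n : ℕ} (c₁ c₂ : ℝ) (Ω : Set (Space n)) : Set (Space n) :=
  {X | ∃ x ∈ Ω, ∃ r ∈ Set.Icc c₁ c₂, X = r • x}

/-- `X/|X| · (Y - X)/|Y - X| ≥ κ`, the condition for refraction at `X` into `Y`. The points `Y` form
the cone `C_X` with vertex `X` (the vertex itself is left out). -/
def refractionCone {n : ℕ} (κ : ℝ) (X : Space n) : Set (Space n) :=
  {Y | κ ≤ ⟪dir X, dir (Y - X)⟫}

/-- The point `m_λ = (1 - λ) m̄ + λ m̂` of the chord. -/
def chord {n : ℕ} (mbar mhat : Space n) (l : ℝ) : Space n := (1 - l) • mbar + l • mhat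

/-- `β(λ)`: the smaller root `β` of `|x₀/κ + β ξ| = 1` with `ξ = m_λ - x₀/κ`. -/
def beta {n : ℕ} (κ : ℝ) (x₀ mbar mhat : Space n) (l : ℝ) : ℝ :=
  let ξ : Space n := chord mbar mhat l - κ⁻¹ • x₀
  (-⟪x₀, ξ⟫ - √(⟪x₀, ξ⟫ ^ 2 - (1 - κ ^ 2) * ‖ξ‖ ^ 2)) / (κ * ‖ξ‖ ^ 2)

/-- `m(λ) = x₀/κ + β(λ) (m_λ - x₀/κ)`, the parametrization of the curve `[m̄, m̂]_{x₀}` in which the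
triangle with vertices `m̄`, `m̂`, `x₀/κ` meets the unit sphere. -/
def curvePt {n : ℕ} (κ : ℝ) (x₀ mbar mhat : Space n) (l : ℝ) : Space n :=
  κ⁻¹ • x₀ + beta κ x₀ mbar mhat l • (chord mbar mhat l - κ⁻¹ • x₀)

/-- The curve `[m̄, m̂]_{x₀}`. -/
def curve {n : ℕ} (κ : ℝ) (x₀ mbar mhat : Space n) : Set (Space n) :=
  curvePt κ x₀ mbar mhat '' Set.Icc 0 1

/-- The point `Y(λ) = X₀ + s_{X₀}(m(λ)) m(λ)` of the curve `[Ȳ, Ŷ]_{X₀}` on the target. -/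
def targetCurvePt {n : ℕ} (κ : ℝ) (s : Space n → Space n → ℝ) (X₀ Ybar Yhat : Space n) (l : ℝ) :
    Space n :=
  let m : Space n := curvePt κ (dir X₀) (dir (Ybar - X₀)) (dir (Yhat - X₀)) l
  X₀ + s X₀ m • m

/-- Visibility of the target `T` from `Γ_{c₁c₂}`: `T ⊆ ⋂ C_X`, and from each `X ∈ Γ_{c₁c₂}` the target
is a polar graph `s_X` over a set `E(X)` of directions which is convex with respect to the curves
`[m̄, m̂]_x`, the functions `s_X` being uniformly Lipschitz. -/
structure HypA {n : ℕ} (κ c₁ c₂ : ℝ) (Ω T : Set (Space n)) (E : Space n → Set (Space n))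
    (s : Space n → Space n → ℝ) : Prop where
  subset_cone : ∀ X ∈ Gam c₁ c₂ Ω, T ⊆ refractionCone κ X
  directions : ∀ X ∈ Gam c₁ c₂ Ω, E X ⊆ {m | m ∈ unitSphere n ∧ κ ≤ ⟪m, dir X⟫}
  cont : ∀ X ∈ Gam c₁ c₂ Ω, ContinuousOn (s X) (E X)
  pos : ∀ X ∈ Gam c₁ c₂ Ω, ∀ m ∈ E X, 0 < s X m
  graph : ∀ X ∈ Gam c₁ c₂ Ω, T = (fun m => X + s X m • m) '' E X
  convex : ∀ X ∈ Gam c₁ c₂ Ω, ∀ mbar ∈ E X, ∀ mhat ∈ E X, curve κ (dir X) mbar mhat ⊆ E X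
  lipschitz : ∃ C > 0, ∀ X ∈ Gam c₁ c₂ Ω, ∀ m₁ ∈ E X, ∀ m₂ ∈ E X,
    |s X m₁ - s X m₂| ≤ C * ‖m₁ - m₂‖

/-- The target is far from `Γ_{c₁c₂}`. -/
def HypB {n : ℕ} (κ c₁ c₂ : ℝ) (Ω T : Set (Space n)) : Prop :=
  ∀ X ∈ Gam c₁ c₂ Ω, ∀ Y ∈ T, ‖X‖ / ‖Y - X‖ ≤ κ * (√(1 + ((1 + κ) ^ 2)⁻¹) - 1)

/-- The concavity condition on the functions `s_X`. -/
def HypC {n : ℕ} (κ c₁ c₂ : ℝ) (Ω : Set (Space n)) (E : Space n → Set (Space n))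
    (s : Space n → Space n → ℝ) : Prop :=
  ∃ μ : ℝ, 0 ≤ μ ∧ μ < κ ∧
    ∀ X₀ ∈ Gam c₁ c₂ Ω, ∀ mbar ∈ E X₀, ∀ mhat ∈ E X₀, ∀ l ∈ Set.Icc (0 : ℝ) 1,
      (1 - l) * beta κ (dir X₀) mbar mhat l * (1 / s X₀ mbar + μ / ‖X₀‖) +
          l * beta κ (dir X₀) mbar mhat l * (1 / s X₀ mhat + μ / ‖X₀‖) ≤
        1 / s X₀ (curvePt κ (dir X₀) mbar mhat l) + μ / ‖X₀‖

/-- The lower bound for the measure of the part of the target near the middle portion of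
`[Ȳ, Ŷ]_{X₀}`. -/
def HypD {n : ℕ} (κ c₁ c₂ : ℝ) (Ω T : Set (Space n)) (s : Space n → Space n → ℝ) : Prop :=
  ∃ μ₀ > 0, ∃ C > 0, ∀ X₀ ∈ Gam c₁ c₂ Ω, ∀ Ybar ∈ T, ∀ Yhat ∈ T, ∀ μ : ℝ, 0 < μ → μ ≤ μ₀ →
    ENNReal.ofReal (C * μ ^ (n - 2) * ‖Ybar - Yhat‖) ≤
      μH[(n : ℝ) - 1]
        (Metric.thickening μ (targetCurvePt κ s X₀ Ybar Yhat '' Set.Icc (1 / 4) (3 / 4)) ∩ T)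

/-- `∂u(x₀)`: the points `Y` of the target whose oval through `X₀ = u(x₀) x₀` supports `u` on `Ω`. -/
def subdiff {n : ℕ} (κ : ℝ) (Ω T : Set (Space n)) (u : Space n → ℝ) (x₀ : Space n) :
    Set (Space n) :=
  {Y | Y ∈ T ∧ ∀ x ∈ Ω, h κ x Y (u x₀ • x₀) ≤ u x}

/-- `u : Ω → [c₁, c₂]` is a refractor from `Ω` to `T`. Only the values of `u` on `Ω` matter. -/
def IsRefractor {n : ℕ} (κ c₁ c₂ : ℝ) (Ω T : Set (Space n)) (u : Space n → ℝ) : Prop :=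
  (∀ x ∈ Ω, u x ∈ Set.Icc c₁ c₂) ∧ ∀ x₀ ∈ Ω, (subdiff κ Ω T u x₀).Nonempty

/-- `H^{n-1}(∂u(B_σ ∩ S^{n-1})) ≤ C σ^{n-1}` whenever `B_σ ∩ S^{n-1} ⊆ Ω`. -/
def MeasureBound {n : ℕ} (κ : ℝ) (Ω T : Set (Space n)) (u : Space n → ℝ) : Prop :=
  ∃ C : ℝ, ∀ z ∈ unitSphere n, ∀ σ : ℝ, 0 < σ → Metric.ball z σ ∩ unitSphere n ⊆ Ω →
    μH[(n : ℝ) - 1] (⋃ x ∈ Metric.ball z σ ∩ unitSphere n, subdiff κ Ω T u x) ≤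
      ENNReal.ofReal (C * σ ^ (n - 1))

/-- The extension `ũ(X) = u(X/|X|)`, homogeneous of degree zero. -/
def radialExt {n : ℕ} (u : Space n → ℝ) (X : Space n) : ℝ := u (dir X)

/-- `u ∈ C^{1,α}_loc(Ω)` for a relatively open set `Ω` of the sphere: `u` is differentiable on `Ω` and
its tangential gradient, which at a point of the sphere is the gradient of the extension `ũ`, is
Hölder continuous with exponent `α` on each compact subset of `Ω`. -/
def IsC1HolderLoc {n : ℕ} (α : ℝ) (Ω : Set (Space n)) (u : Space n → ℝ) : Prop :=
  (∀ x ∈ Ω, DifferentiableAt ℝ (radialExt u) x) ∧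
    ∀ K ⊆ Ω, IsCompact K → ∃ C : ℝ, ∀ x ∈ K, ∀ y ∈ K,
      ‖gradient (radialExt u) x - gradient (radialExt u) y‖ ≤ C * ‖x - y‖ ^ α

end NearField

end

/-!
A target point `Y` lies in `∂u(x₀)` exactly when the graph point `u(x₀) x₀` minimizes the optical
length `|X| + κ |X - Y|` over the graph of `u`. If `Ȳ ∈ ∂u(x̄)` and `Ŷ ∈ ∂u(x̂)`, then H.C makes
the optical length to a point `Y(λ)` of the middle of the curve `[Ȳ, Ŷ]` exceed its value at `x̄` by
a multiple of `|Ȳ - Ŷ|² |X - X̄|²`, up to an error controlled by `|x̄ - x̂| |Ȳ - Ŷ|`. Hence every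
target point within a multiple of `σ |Ȳ - Ŷ|²` of the curve has its minimum within a multiple of `σ`
of `x̄`, provided that `σ² ≥ C |x̄ - x̂| / |Ȳ - Ŷ|`. Comparing H.D with the measure bound for the
image of this cap at the smallest admissible scale yields `|Ȳ - Ŷ|^(4n - 5) ≤ C |x̄ - x̂|`. This
Hölder continuity of `∂u` passes to the gradient of `u`, which is that of the supporting oval.
-/

noncomputable section

namespace NearField

section OpticalLength

variable {V : Type*} [NormedAddCommGroup V]

/-- The optical length `|X| + κ |X - Y|`, whose level sets are the Descartes ovals with focus
`Y`. -/
def opticalLength (κ : ℝ) (Y X : V) : ℝ := ‖X‖ + κ * ‖X - Y‖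

theorem abs_opticalLength_sub_sub_le {κ : ℝ} (hκ0 : 0 ≤ κ) (Y X X' : V) :
    |opticalLength κ Y X - opticalLength κ Y X' - (‖X‖ - ‖X'‖)| ≤ κ * ‖X - X'‖ := by
  have hdist := abs_norm_sub_norm_le (X - Y) (X' - Y)
  rw [sub_sub_sub_cancel_right] at hdist
  have hsplit : opticalLength κ Y X - opticalLength κ Y X' - (‖X‖ - ‖X'‖) =
      κ * (‖X - Y‖ - ‖X' - Y‖) := by
    unfold opticalLength; ring
  rw [hsplit, abs_mul, abs_of_nonneg hκ0]
  gcongr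

theorem slope_le_ray_sub [NormedSpace ℝ V] {κ : ℝ} (hκ0 : 0 ≤ κ) {x : V} (hx : ‖x‖ = 1) (Y : V)
    {r t : ℝ} (hrt : r ≤ t) :
    (1 - κ) * (t - r) ≤ (t + κ * ‖t • x - Y‖) - (r + κ * ‖r • x - Y‖) := by
  have htri := norm_sub_norm_le (r • x - Y) (t • x - Y)
  rw [sub_sub_sub_cancel_right, ← sub_smul, norm_smul, hx, mul_one, Real.norm_eq_abs, abs_sub_comm,
    abs_of_nonneg (sub_nonneg.2 hrt)] at htri
  linarith [mul_le_mul_of_nonneg_left htri hκ0]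

theorem strictMono_ray [NormedSpace ℝ V] {κ : ℝ} (hκ0 : 0 ≤ κ) (hκ1 : κ < 1) {x : V}
    (hx : ‖x‖ = 1) (Y : V) : StrictMono fun t : ℝ => t + κ * ‖t • x - Y‖ := fun r t hrt => by
  have := slope_le_ray_sub hκ0 hx Y hrt.le
  linarith [mul_pos (sub_pos.2 hκ1) (sub_pos.2 hrt)]

end OpticalLength

section MixedDifference

variable {V : Type*} [NormedAddCommGroup V]

theorem norm_inv_smul_sub_inv_smul_le [NormedSpace ℝ V] {p q : V} {a b : ℝ} (ha : 0 < a)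
    (hb : ‖q‖ ≤ b) : ‖a⁻¹ • p - b⁻¹ • q‖ ≤ a⁻¹ * (‖p - q‖ + |a - b|) := by
  have hq : ‖b⁻¹ • q‖ ≤ 1 := by
    rw [norm_smul, norm_inv, Real.norm_of_nonneg ((norm_nonneg q).trans hb)]
    exact inv_mul_le_one_of_le₀ hb ((norm_nonneg q).trans hb)
  have hsplit : a⁻¹ • p - b⁻¹ • q = a⁻¹ • ((p - q) + (b - a) • (b⁻¹ • q)) := by
    rcases eq_or_ne b 0 with rfl | hb0
    · obtain rfl : q = 0 := norm_le_zero_iff.1 hb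
      simp
    · match_scalars <;> field_simp
      ring
  rw [hsplit, norm_smul, Real.norm_of_nonneg (inv_nonneg.2 ha.le)]
  gcongr
  refine (norm_add_le _ _).trans ?_
  rw [norm_smul, Real.norm_eq_abs, abs_sub_comm b]
  gcongr
  exact mul_le_of_le_one_right (abs_nonneg _) hq

theorem norm_sub_norm_eq_inner [InnerProductSpace ℝ V] (U W : V) :
    ‖U‖ - ‖W‖ = ⟪U - W, (‖U‖ + ‖W‖)⁻¹ • (U + W)⟫ := by
  have hinner : ⟪U - W, U + W⟫ = (‖U‖ + ‖W‖) * (‖U‖ - ‖W‖) := by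
    rw [inner_sub_left, inner_add_right, inner_add_right, real_inner_comm U W,
      real_inner_self_eq_norm_sq, real_inner_self_eq_norm_sq]
    ring
  rw [inner_smul_right, hinner]
  rcases eq_or_ne (‖U‖ + ‖W‖) 0 with h0 | h0
  · have hU := norm_nonneg U
    have hW := norm_nonneg W
    rw [h0, inv_zero, zero_mul]
    linarith
  · exact (inv_mul_cancel_left₀ h0 _).symm

theorem abs_mixed_dist_le [InnerProductSpace ℝ V] {X X' Y Y' : V} {r : ℝ} (hr : 0 < r)
    (hX : r ≤ ‖X - Y‖) (hX' : r ≤ ‖X' - Y‖) :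
    |(‖X - Y‖ - ‖X' - Y‖) - (‖X - Y'‖ - ‖X' - Y'‖)| ≤ 2 / r * ‖X - X'‖ * ‖Y - Y'‖ := by
  have hshift : ∀ Z : V, |‖Z - Y‖ - ‖Z - Y'‖| ≤ ‖Y - Y'‖ := fun Z => by
    simpa [norm_sub_rev] using abs_norm_sub_norm_le (Z - Y) (Z - Y')
  set a := ‖X - Y‖ + ‖X' - Y‖ with ha
  set b := ‖X - Y'‖ + ‖X' - Y'‖ with hb
  have hab : |a - b| ≤ 2 * ‖Y - Y'‖ := by
    rw [ha, hb, add_sub_add_comm, two_mul]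
    exact (abs_add_le _ _).trans (add_le_add (hshift X) (hshift X'))
  have hpq : ‖(X - Y) + (X' - Y) - ((X - Y') + (X' - Y'))‖ = 2 * ‖Y - Y'‖ := by
    rw [show (X - Y) + (X' - Y) - ((X - Y') + (X' - Y')) = (-2 : ℝ) • (Y - Y') by module, norm_smul]
    norm_num
  rw [norm_sub_norm_eq_inner (X - Y), norm_sub_norm_eq_inner (X - Y'), sub_sub_sub_cancel_right,
    sub_sub_sub_cancel_right, ← inner_sub_right, ← ha, ← hb]
  have h2r : 2 * r ≤ a := by rw [ha]; linarith
  calc _ ≤ ‖X - X'‖ * ‖a⁻¹ • ((X - Y) + (X' - Y)) - b⁻¹ • ((X - Y') + (X' - Y'))‖ :=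
        abs_real_inner_le_norm _ _
    _ ≤ ‖X - X'‖ * (a⁻¹ * (2 * ‖Y - Y'‖ + 2 * ‖Y - Y'‖)) := by
        grw [norm_inv_smul_sub_inv_smul_le (by linarith) (norm_add_le _ _), hpq, hab]
    _ ≤ ‖X - X'‖ * ((2 * r)⁻¹ * (2 * ‖Y - Y'‖ + 2 * ‖Y - Y'‖)) := by gcongr
    _ = 2 / r * ‖X - X'‖ * ‖Y - Y'‖ := by field_simp; ring

end MixedDifference

section Oval

variable {n : ℕ}

/-- The ray through `x` meets the Descartes oval at the polar radius. -/
theorem ovalRadius_spec {κ : ℝ} (hκ0 : 0 ≤ κ) (hκ1 : κ < 1) {x : Space n} (hx : ‖x‖ = 1)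
    (Y : Space n) (b : ℝ) :
    ovalRadius κ x Y b + κ * ‖ovalRadius κ x Y b • x - Y‖ = b := by
  have hk : 0 < 1 - κ ^ 2 := by nlinarith
  set t := ovalRadius κ x Y b with ht
  set B := b - κ ^ 2 * ⟪x, Y⟫ with hB
  set D := B ^ 2 - (1 - κ ^ 2) * (b ^ 2 - κ ^ 2 * ‖Y‖ ^ 2) with hD
  have hdisc : ∀ r : ℝ, D =
      ((1 - κ ^ 2) * r - B) ^ 2 + (1 - κ ^ 2) * ((κ * ‖r • x - Y‖) ^ 2 - (b - r) ^ 2) := by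
    intro r
    rw [mul_pow, norm_sub_sq_real, norm_smul, hx, real_inner_smul_left, Real.norm_eq_abs, mul_one,
      sq_abs, hD, hB]
    ring
  have hb : ((1 - κ ^ 2) * b - B) ^ 2 ≤ D := by
    rw [hdisc b, sub_self]
    nlinarith [sq_nonneg (κ * ‖b • x - Y‖)]
  have hroot : (1 - κ ^ 2) * t = B - √D := by
    rw [ht, ovalRadius, mul_div_cancel₀ _ hk.ne']
  have htb : t ≤ b := by
    have := neg_le_of_abs_le (Real.abs_le_sqrt hb)
    exact le_of_mul_le_mul_left (by linarith) hk
  have hsq : (κ * ‖t • x - Y‖) ^ 2 = (b - t) ^ 2 := by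
    have hDt := hdisc t
    rw [hroot, sub_sub_cancel_left, neg_sq, Real.sq_sqrt ((sq_nonneg _).trans hb)] at hDt
    have hzero := (mul_eq_zero_iff_left hk.ne').1 (left_eq_add.1 hDt)
    linarith
  have := (pow_left_inj₀ (by positivity) (sub_nonneg.2 htb) two_ne_zero).1 hsq
  linarith

theorem ovalRadius_le_iff {κ : ℝ} (hκ0 : 0 ≤ κ) (hκ1 : κ < 1) {x : Space n} (hx : ‖x‖ = 1)
    (Y : Space n) (b t : ℝ) : ovalRadius κ x Y b ≤ t ↔ b ≤ t + κ * ‖t • x - Y‖ := by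
  conv_rhs => rw [← ovalRadius_spec hκ0 hκ1 hx Y b]
  exact ((strictMono_ray hκ0 hκ1 hx Y).le_iff_le).symm

end Oval

section Curve

variable {n : ℕ} {κ l : ℝ} {x₀ mbar mhat : Space n}

theorem norm_chord_sq (hbar : ‖mbar‖ = 1) (hhat : ‖mhat‖ = 1) :
    ‖chord mbar mhat l‖ ^ 2 = 1 - l * (1 - l) * ‖mbar - mhat‖ ^ 2 := by
  unfold chord
  rw [norm_add_sq_real, norm_sub_sq_real, norm_smul, norm_smul, real_inner_smul_left,
    real_inner_smul_right, hbar, hhat, mul_one, mul_one, Real.norm_eq_abs, Real.norm_eq_abs, sq_abs,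
    sq_abs]
  ring

theorem norm_chord_le_one (hbar : ‖mbar‖ = 1) (hhat : ‖mhat‖ = 1) (hl : l ∈ Set.Icc (0 : ℝ) 1) :
    ‖chord mbar mhat l‖ ≤ 1 := by
  rw [← sq_le_one_iff₀ (norm_nonneg _), norm_chord_sq hbar hhat]
  linarith [mul_nonneg (mul_nonneg hl.1 (sub_nonneg.2 hl.2)) (sq_nonneg ‖mbar - mhat‖)]

theorem le_inner_chord (hbar : κ ≤ ⟪mbar, x₀⟫) (hhat : κ ≤ ⟪mhat, x₀⟫)
    (hl : l ∈ Set.Icc (0 : ℝ) 1) : κ ≤ ⟪chord mbar mhat l, x₀⟫ := by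
  rw [chord, inner_add_left, real_inner_smul_left, real_inner_smul_left]
  nlinarith [mul_nonneg (sub_nonneg.2 hl.2) (sub_nonneg.2 hbar),
    mul_nonneg hl.1 (sub_nonneg.2 hhat)]

theorem norm_chord_sub_left_le (hl : l ∈ Set.Icc (0 : ℝ) 1) :
    ‖chord mbar mhat l - mbar‖ ≤ ‖mbar - mhat‖ := by
  rw [show chord mbar mhat l - mbar = -l • (mbar - mhat) by unfold chord; module, norm_smul,
    norm_neg, Real.norm_of_nonneg hl.1]
  exact mul_le_of_le_one_left (norm_nonneg _) hl.2

theorem norm_chord_sub_right_le (hl : l ∈ Set.Icc (0 : ℝ) 1) :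
    ‖chord mbar mhat l - mhat‖ ≤ ‖mbar - mhat‖ := by
  rw [show chord mbar mhat l - mhat = (1 - l) • (mbar - mhat) by unfold chord; module, norm_smul,
    Real.norm_of_nonneg (sub_nonneg.2 hl.2)]
  exact mul_le_of_le_one_left (norm_nonneg _) (sub_le_self _ hl.1)

theorem curvePt_sub_chord (κ : ℝ) (x₀ mbar mhat : Space n) (l : ℝ) :
    curvePt κ x₀ mbar mhat l - chord mbar mhat l =
      (1 - beta κ x₀ mbar mhat l) • (κ⁻¹ • x₀ - chord mbar mhat l) := by
  unfold curvePt; module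

theorem discrim_eq (hκ : κ ≠ 0) (hx₀ : ‖x₀‖ = 1) (c : Space n) :
    ⟪x₀, c - κ⁻¹ • x₀⟫ ^ 2 - (1 - κ ^ 2) * ‖c - κ⁻¹ • x₀‖ ^ 2 =
      (κ * ‖c - κ⁻¹ • x₀‖ ^ 2 + ⟪x₀, c - κ⁻¹ • x₀⟫) ^ 2 +
        κ ^ 2 * (1 - ‖c‖ ^ 2) * ‖c - κ⁻¹ • x₀‖ ^ 2 := by
  have hnorm : κ ^ 2 * ‖c‖ ^ 2 =
      κ ^ 2 * ‖c - κ⁻¹ • x₀‖ ^ 2 + 2 * κ * ⟪x₀, c - κ⁻¹ • x₀⟫ + 1 := by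
    conv_lhs => rw [← sub_add_cancel c (κ⁻¹ • x₀), norm_add_sq_real, norm_smul, hx₀,
      real_inner_smul_right, real_inner_comm, norm_inv, Real.norm_eq_abs, mul_one, inv_pow, sq_abs]
    field_simp
  linear_combination ‖c - κ⁻¹ • x₀‖ ^ 2 * hnorm

theorem inv_sub_one_le_norm (hκ0 : 0 < κ) (hx₀ : ‖x₀‖ = 1) {c : Space n} (hc : ‖c‖ ≤ 1) :
    κ⁻¹ - 1 ≤ ‖c - κ⁻¹ • x₀‖ := by
  have := norm_sub_norm_le (κ⁻¹ • x₀) c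
  rw [norm_sub_rev, norm_smul, hx₀, mul_one, Real.norm_of_nonneg (inv_nonneg.2 hκ0.le)] at this
  linarith

theorem norm_le_inv_add_one (hκ0 : 0 < κ) (hx₀ : ‖x₀‖ = 1) {c : Space n} (hc : ‖c‖ ≤ 1) :
    ‖c - κ⁻¹ • x₀‖ ≤ κ⁻¹ + 1 := by
  have := norm_sub_le c (κ⁻¹ • x₀)
  rw [norm_smul, hx₀, mul_one, Real.norm_of_nonneg (inv_nonneg.2 hκ0.le)] at this
  linarith

variable (hκ0 : 0 < κ) (hκ1 : κ < 1) (hx₀ : ‖x₀‖ = 1) (hc : ‖chord mbar mhat l‖ ≤ 1)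
include hκ0 hκ1 hx₀ hc

theorem norm_chord_sub_pos : 0 < ‖chord mbar mhat l - κ⁻¹ • x₀‖ := by
  linarith [inv_sub_one_le_norm hκ0 hx₀ hc, (one_lt_inv₀ hκ0).2 hκ1]

theorem beta_nonneg : 0 ≤ beta κ x₀ mbar mhat l := by
  have ha : ⟪x₀, chord mbar mhat l - κ⁻¹ • x₀⟫ ≤ 0 := by
    have hle := (real_inner_le_norm x₀ (chord mbar mhat l)).trans
      (mul_le_one₀ hx₀.le (norm_nonneg _) hc)
    rw [inner_sub_right, real_inner_smul_right, real_inner_self_eq_norm_sq, hx₀, one_pow, mul_one]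
    linarith [(one_lt_inv₀ hκ0).2 hκ1]
  refine div_nonneg (sub_nonneg.2 (Real.sqrt_le_left (neg_nonneg.2 ha) |>.2 ?_)) (by positivity)
  have hk : 0 ≤ 1 - κ ^ 2 := by nlinarith
  rw [neg_sq]
  exact sub_le_self _ (by positivity)

theorem beta_le_one : beta κ x₀ mbar mhat l ≤ 1 := by
  have hN := norm_chord_sub_pos hκ0 hκ1 hx₀ hc
  have hk : 0 ≤ 1 - ‖chord mbar mhat l‖ ^ 2 := by
    linarith [pow_le_one₀ (norm_nonneg _) hc (n := 2)]
  have hsqrt := neg_le_of_abs_le <| Real.abs_le_sqrt <|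
    (le_add_of_nonneg_right (by positivity)).trans_eq
      (discrim_eq hκ0.ne' hx₀ (chord mbar mhat l)).symm
  refine div_le_one_of_le₀ ?_ (by positivity)
  linarith

theorem norm_curvePt : ‖curvePt κ x₀ mbar mhat l‖ = 1 := by
  have hN := norm_chord_sub_pos hκ0 hκ1 hx₀ hc
  have hk : 0 ≤ 1 - ‖chord mbar mhat l‖ ^ 2 := by
    linarith [pow_le_one₀ (norm_nonneg _) hc (n := 2)]
  set ξ := chord mbar mhat l - κ⁻¹ • x₀ with hξ
  have hD : 0 ≤ ⟪x₀, ξ⟫ ^ 2 - (1 - κ ^ 2) * ‖ξ‖ ^ 2 := by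
    rw [hξ, discrim_eq hκ0.ne' hx₀]; positivity
  have hroot : beta κ x₀ mbar mhat l * (κ * ‖ξ‖ ^ 2) + ⟪x₀, ξ⟫ =
      -√(⟪x₀, ξ⟫ ^ 2 - (1 - κ ^ 2) * ‖ξ‖ ^ 2) := by
    rw [beta, div_mul_cancel₀ _ (by positivity)]
    ring
  have hsq := congrArg (· ^ 2) hroot
  simp only [neg_sq, Real.sq_sqrt hD] at hsq
  rw [← sq_eq_sq₀ (norm_nonneg _) zero_le_one, curvePt, norm_add_sq_real, real_inner_smul_left,
    real_inner_smul_right, norm_smul, norm_smul, hx₀, norm_inv, Real.norm_of_nonneg hκ0.le,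
    mul_pow ‖beta _ _ _ _ _‖, Real.norm_eq_abs, sq_abs, ← hξ]
  field_simp
  refine mul_left_cancel₀ (pow_ne_zero 2 hN.ne') ?_
  linear_combination hsq

theorem one_sub_norm_chord_sq_le :
    1 - ‖chord mbar mhat l‖ ^ 2 ≤ 2 * (κ⁻¹ + 1) * (1 - beta κ x₀ mbar mhat l) := by
  have hnorm := norm_sub_norm_le (curvePt κ x₀ mbar mhat l) (chord mbar mhat l)
  rw [curvePt_sub_chord, norm_smul, norm_sub_rev (κ⁻¹ • x₀), norm_curvePt hκ0 hκ1 hx₀ hc,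
    Real.norm_of_nonneg (sub_nonneg.2 (beta_le_one hκ0 hκ1 hx₀ hc))] at hnorm
  have hle := hnorm.trans (mul_le_mul_of_nonneg_left (norm_le_inv_add_one hκ0 hx₀ hc)
    (sub_nonneg.2 (beta_le_one hκ0 hκ1 hx₀ hc)))
  nlinarith [norm_nonneg (chord mbar mhat l)]

theorem norm_curvePt_sub_chord_sq_le (hcx : κ ≤ ⟪chord mbar mhat l, x₀⟫) :
    ‖curvePt κ x₀ mbar mhat l - chord mbar mhat l‖ ^ 2 ≤ 1 - ‖chord mbar mhat l‖ ^ 2 := by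
  have hinner : 0 ≤ ⟪chord mbar mhat l, curvePt κ x₀ mbar mhat l - chord mbar mhat l⟫ := by
    rw [curvePt_sub_chord, real_inner_smul_right, inner_sub_right, real_inner_smul_right,
      real_inner_self_eq_norm_sq]
    have hone : 1 ≤ κ⁻¹ * ⟪chord mbar mhat l, x₀⟫ := by
      rwa [inv_mul_eq_div, one_le_div hκ0]
    exact mul_nonneg (sub_nonneg.2 (beta_le_one hκ0 hκ1 hx₀ hc))
      (by linarith [pow_le_one₀ (norm_nonneg _) hc (n := 2)])
  have hexp := norm_add_sq_real (chord mbar mhat l)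
    (curvePt κ x₀ mbar mhat l - chord mbar mhat l)
  rw [add_sub_cancel, norm_curvePt hκ0 hκ1 hx₀ hc] at hexp
  linarith

end Curve

section UnitDirections

variable {n : ℕ} {κ l : ℝ} {x₀ mbar mhat : Space n} (hκ0 : 0 < κ) (hκ1 : κ < 1) (hx₀ : ‖x₀‖ = 1)
  (hbar : ‖mbar‖ = 1) (hhat : ‖mhat‖ = 1) (hl : l ∈ Set.Icc (0 : ℝ) 1)
include hκ0 hκ1 hx₀ hbar hhat hl

theorem mul_norm_sub_sq_le_one_sub_beta :
    l * (1 - l) * ‖mbar - mhat‖ ^ 2 ≤ 2 * (κ⁻¹ + 1) * (1 - beta κ x₀ mbar mhat l) := by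
  have := one_sub_norm_chord_sq_le hκ0 hκ1 hx₀ (norm_chord_le_one hbar hhat hl)
  rwa [norm_chord_sq hbar hhat, sub_sub_cancel] at this

variable (hbarx : κ ≤ ⟪mbar, x₀⟫) (hhatx : κ ≤ ⟪mhat, x₀⟫)
include hbarx hhatx

theorem norm_curvePt_sub_chord_le :
    ‖curvePt κ x₀ mbar mhat l - chord mbar mhat l‖ ≤ ‖mbar - mhat‖ := by
  have hsq := norm_curvePt_sub_chord_sq_le hκ0 hκ1 hx₀ (norm_chord_le_one hbar hhat hl)
    (le_inner_chord hbarx hhatx hl)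
  rw [norm_chord_sq hbar hhat, sub_sub_cancel] at hsq
  refine (pow_le_pow_iff_left₀ (norm_nonneg _) (norm_nonneg _) two_ne_zero).1 (hsq.trans ?_)
  exact mul_le_of_le_one_left (sq_nonneg _)
    (mul_le_one₀ hl.2 (sub_nonneg.2 hl.2) (sub_le_self _ hl.1))

theorem norm_curvePt_sub_left_le :
    ‖curvePt κ x₀ mbar mhat l - mbar‖ ≤ 2 * ‖mbar - mhat‖ := by
  rw [two_mul]
  exact (norm_sub_le_norm_sub_add_norm_sub _ (chord mbar mhat l) _).trans <| add_le_add
    (norm_curvePt_sub_chord_le hκ0 hκ1 hx₀ hbar hhat hl hbarx hhatx) (norm_chord_sub_left_le hl)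

theorem norm_curvePt_sub_right_le :
    ‖curvePt κ x₀ mbar mhat l - mhat‖ ≤ 2 * ‖mbar - mhat‖ := by
  rw [two_mul]
  exact (norm_sub_le_norm_sub_add_norm_sub _ (chord mbar mhat l) _).trans <| add_le_add
    (norm_curvePt_sub_chord_le hκ0 hκ1 hx₀ hbar hhat hl hbarx hhatx) (norm_chord_sub_right_le hl)

theorem one_sub_beta_le :
    1 - beta κ x₀ mbar mhat l ≤ (κ⁻¹ - 1)⁻¹ * ‖mbar - mhat‖ := by
  have hc := norm_chord_le_one hbar hhat hl
  have hinv : 0 < κ⁻¹ - 1 := sub_pos.2 ((one_lt_inv₀ hκ0).2 hκ1)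
  have hβ : 0 ≤ 1 - beta κ x₀ mbar mhat l := sub_nonneg.2 (beta_le_one hκ0 hκ1 hx₀ hc)
  have hle := norm_curvePt_sub_chord_le hκ0 hκ1 hx₀ hbar hhat hl hbarx hhatx
  rw [curvePt_sub_chord, norm_smul, Real.norm_of_nonneg hβ, norm_sub_rev] at hle
  rw [le_inv_mul_iff₀ hinv, mul_comm]
  exact (mul_le_mul_of_nonneg_left (inv_sub_one_le_norm hκ0 hx₀ hc) hβ).trans hle

end UnitDirections

section Dir

variable {n : ℕ}

theorem norm_dir {X : Space n} (hX : X ≠ 0) : ‖dir X‖ = 1 := by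
  rw [dir, norm_smul, norm_inv, norm_norm, inv_mul_cancel₀ (norm_ne_zero_iff.2 hX)]

theorem norm_smul_dir (X : Space n) : ‖X‖ • dir X = X := by
  rcases eq_or_ne X 0 with rfl | hX
  · rw [norm_zero, zero_smul]
  · exact smul_inv_smul₀ (norm_ne_zero_iff.2 hX) X

theorem dir_smul_unit {r : ℝ} (hr : 0 < r) {x : Space n} (hx : ‖x‖ = 1) : dir (r • x) = x := by
  rw [dir, norm_smul, hx, mul_one, Real.norm_of_nonneg hr.le, inv_smul_smul₀ hr.ne']

theorem dir_eq_self {x : Space n} (hx : ‖x‖ = 1) : dir x = x := by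
  rw [dir, hx, inv_one, one_smul]

theorem norm_dir_sub_dir_le {X : Space n} (hX : X ≠ 0) (Z : Space n) :
    ‖dir X - dir Z‖ ≤ 2 / ‖X‖ * ‖X - Z‖ := by
  calc ‖dir X - dir Z‖ ≤ ‖X‖⁻¹ * (‖X - Z‖ + |‖X‖ - ‖Z‖|) :=
        norm_inv_smul_sub_inv_smul_le (norm_pos_iff.2 hX) le_rfl
    _ ≤ ‖X‖⁻¹ * (‖X - Z‖ + ‖X - Z‖) := by gcongr; exact abs_norm_sub_norm_le X Z
    _ = 2 / ‖X‖ * ‖X - Z‖ := by ring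

theorem norm_of_mem {Ω : Set (Space n)} (hΩ : Ω ⊆ unitSphere n) {x : Space n} (hx : x ∈ Ω) :
    ‖x‖ = 1 := mem_sphere_zero_iff_norm.1 (hΩ hx)

variable {c₁ c₂ : ℝ} {Ω : Set (Space n)}

theorem norm_mem_of_mem_Gam (hc₁ : 0 < c₁) (hΩ : Ω ⊆ unitSphere n) {X : Space n}
    (hX : X ∈ Gam c₁ c₂ Ω) : ‖X‖ ∈ Set.Icc c₁ c₂ := by
  obtain ⟨x, hx, r, hr, rfl⟩ := hX
  rwa [norm_smul, norm_of_mem hΩ hx, mul_one, Real.norm_of_nonneg (hc₁.le.trans hr.1)]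

theorem ne_zero_of_mem_Gam (hc₁ : 0 < c₁) (hΩ : Ω ⊆ unitSphere n) {X : Space n}
    (hX : X ∈ Gam c₁ c₂ Ω) : X ≠ 0 :=
  norm_pos_iff.1 (hc₁.trans_le (norm_mem_of_mem_Gam hc₁ hΩ hX).1)

theorem smul_dir_mem_Gam (hc₁ : 0 < c₁) (hΩ : Ω ⊆ unitSphere n) {X : Space n}
    (hX : X ∈ Gam c₁ c₂ Ω) {r : ℝ} (hr : r ∈ Set.Icc c₁ c₂) : r • dir X ∈ Gam c₁ c₂ Ω := by
  obtain ⟨x, hx, t, ht, rfl⟩ := hX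
  rw [dir_smul_unit (hc₁.trans_le ht.1) (norm_of_mem hΩ hx)]
  exact ⟨x, hx, r, hr, rfl⟩

end Dir

section Target

variable {n : ℕ} {κ c₁ c₂ : ℝ} {Ω T : Set (Space n)} {E : Space n → Set (Space n)}
  {s : Space n → Space n → ℝ}

/-- The target is far from `Γ`, in the form in which the argument uses it: every `Y - X` is longer
than the rays of `Γ`, with the factor `1 / κ`. -/
def IsFar (κ c₁ c₂ : ℝ) (Ω T : Set (Space n)) : Prop :=
  ∀ X ∈ Gam c₁ c₂ Ω, ∀ Y ∈ T, c₂ ≤ κ * ‖Y - X‖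

theorem HypA.norm_eq_one (hA : HypA κ c₁ c₂ Ω T E s) {X m : Space n} (hX : X ∈ Gam c₁ c₂ Ω)
    (hm : m ∈ E X) : ‖m‖ = 1 :=
  mem_sphere_zero_iff_norm.1 (hA.directions X hX hm).1

theorem HypA.mem_target (hA : HypA κ c₁ c₂ Ω T E s) {X m : Space n} (hX : X ∈ Gam c₁ c₂ Ω)
    (hm : m ∈ E X) : X + s X m • m ∈ T := by
  rw [hA.graph X hX]
  exact ⟨m, hm, rfl⟩

theorem HypA.dir_sub_mem_and_eq_norm_sub (hA : HypA κ c₁ c₂ Ω T E s) {X Y : Space n}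
    (hX : X ∈ Gam c₁ c₂ Ω) (hY : Y ∈ T) :
    dir (Y - X) ∈ E X ∧ s X (dir (Y - X)) = ‖Y - X‖ := by
  rw [hA.graph X hX] at hY
  obtain ⟨m, hm, rfl⟩ := hY
  have hs := hA.pos X hX m hm
  simp only [add_sub_cancel_left]
  rw [dir_smul_unit hs (hA.norm_eq_one hX hm), norm_smul, hA.norm_eq_one hX hm, mul_one,
    Real.norm_of_nonneg hs.le]
  exact ⟨hm, rfl⟩

theorem HypA.dir_sub_mem (hA : HypA κ c₁ c₂ Ω T E s) {X Y : Space n} (hX : X ∈ Gam c₁ c₂ Ω)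
    (hY : Y ∈ T) : dir (Y - X) ∈ E X :=
  (hA.dir_sub_mem_and_eq_norm_sub hX hY).1

theorem HypA.apply_dir_sub (hA : HypA κ c₁ c₂ Ω T E s) {X Y : Space n} (hX : X ∈ Gam c₁ c₂ Ω)
    (hY : Y ∈ T) : s X (dir (Y - X)) = ‖Y - X‖ :=
  (hA.dir_sub_mem_and_eq_norm_sub hX hY).2

theorem HypA.norm_sub_pos (hA : HypA κ c₁ c₂ Ω T E s) {X Y : Space n} (hX : X ∈ Gam c₁ c₂ Ω)
    (hY : Y ∈ T) : 0 < ‖Y - X‖ :=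
  hA.apply_dir_sub hX hY ▸ hA.pos X hX _ (hA.dir_sub_mem hX hY)

theorem HypA.curvePt_mem (hA : HypA κ c₁ c₂ Ω T E s) {X Ybar Yhat : Space n}
    (hX : X ∈ Gam c₁ c₂ Ω) (hbar : Ybar ∈ T) (hhat : Yhat ∈ T) {l : ℝ}
    (hl : l ∈ Set.Icc (0 : ℝ) 1) :
    curvePt κ (dir X) (dir (Ybar - X)) (dir (Yhat - X)) l ∈ E X :=
  hA.convex X hX _ (hA.dir_sub_mem hX hbar) _ (hA.dir_sub_mem hX hhat) ⟨l, hl, rfl⟩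

theorem HypA.targetCurvePt_mem (hA : HypA κ c₁ c₂ Ω T E s) {X Ybar Yhat : Space n}
    (hX : X ∈ Gam c₁ c₂ Ω) (hbar : Ybar ∈ T) (hhat : Yhat ∈ T) {l : ℝ}
    (hl : l ∈ Set.Icc (0 : ℝ) 1) : targetCurvePt κ s X Ybar Yhat l ∈ T :=
  hA.mem_target hX (hA.curvePt_mem hX hbar hhat hl)

theorem HypB.isFar (hB : HypB κ c₁ c₂ Ω T) (hA : HypA κ c₁ c₂ Ω T E s) (hκ0 : 0 < κ)
    (hc₁ : 0 < c₁) (hc₂ : c₁ ≤ c₂) (hΩ : Ω ⊆ unitSphere n) : IsFar κ c₁ c₂ Ω T := by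
  intro X hX Y hY
  have hXn := norm_mem_of_mem_Gam hc₁ hΩ hX
  have hdir := norm_dir (ne_zero_of_mem_Gam hc₁ hΩ hX)
  have hend := smul_dir_mem_Gam hc₁ hΩ hX (Set.right_mem_Icc.2 hc₂)
  have hratio := hB _ hend Y hY
  rw [div_le_iff₀ (hA.norm_sub_pos hend hY), norm_smul, hdir, mul_one,
    Real.norm_of_nonneg (hc₁.le.trans hc₂)] at hratio
  have htri : ‖Y - c₂ • dir X‖ ≤ ‖Y - X‖ + c₂ := by
    have hshift : Y - c₂ • dir X = (Y - X) - (c₂ - ‖X‖) • dir X := by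
      rw [sub_smul, norm_smul_dir]; abel
    rw [hshift]
    refine (norm_sub_le _ _).trans ?_
    rw [norm_smul, hdir, mul_one, Real.norm_of_nonneg (sub_nonneg.2 hXn.2)]
    linarith [hXn.1]
  have hsqrt : √(1 + ((1 + κ) ^ 2)⁻¹) - 1 ≤ (1 + κ)⁻¹ := by
    rw [sub_le_iff_le_add, Real.sqrt_le_left (by positivity), ← inv_pow]
    linarith [inv_pos.2 (show 0 < 1 + κ by positivity)]
  have hle : c₂ ≤ κ * (1 + κ)⁻¹ * (‖Y - X‖ + c₂) := by
    refine hratio.trans ?_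
    gcongr
  rw [mul_assoc, ← div_eq_inv_mul, mul_div_assoc', le_div_iff₀ (by positivity)] at hle
  linarith

theorem HypA.norm_dir_sub_dir_le_two (hA : HypA κ c₁ c₂ Ω T E s) {X Y Y' : Space n}
    (hX : X ∈ Gam c₁ c₂ Ω) (hY : Y ∈ T) (hY' : Y' ∈ T) :
    ‖dir (Y - X) - dir (Y' - X)‖ ≤ 2 := by
  refine (norm_sub_le _ _).trans ?_
  rw [hA.norm_eq_one hX (hA.dir_sub_mem hX hY), hA.norm_eq_one hX (hA.dir_sub_mem hX hY'),
    one_add_one_eq_two]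

theorem HypA.exists_dist_le (hA : HypA κ c₁ c₂ Ω T E s) (hc₁ : 0 < c₁) (hΩ : Ω ⊆ unitSphere n) :
    ∃ S > 0, ∀ X ∈ Gam c₁ c₂ Ω, ∀ Y ∈ T, ‖Y - X‖ ≤ S := by
  rcases (Gam c₁ c₂ Ω).eq_empty_or_nonempty with hG | ⟨X₁, hX₁⟩
  · exact ⟨1, one_pos, by simp [hG]⟩
  rcases T.eq_empty_or_nonempty with hT | ⟨Y₁, hY₁⟩
  · exact ⟨1, one_pos, by simp [hT]⟩
  obtain ⟨C, hC, hlip⟩ := hA.lipschitz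
  have hX₁n := norm_mem_of_mem_Gam hc₁ hΩ hX₁
  have hc₂ : 0 < c₂ := hc₁.trans_le (hX₁n.1.trans hX₁n.2)
  refine ⟨‖Y₁ - X₁‖ + C * 2 + 2 * c₂, by positivity, fun X hX Y hY => ?_⟩
  have hfrom : ‖Y - X₁‖ ≤ ‖Y₁ - X₁‖ + C * 2 := by
    have hle := hlip X₁ hX₁ _ (hA.dir_sub_mem hX₁ hY) _ (hA.dir_sub_mem hX₁ hY₁)
    rw [hA.apply_dir_sub hX₁ hY, hA.apply_dir_sub hX₁ hY₁] at hle
    linarith [le_abs_self (‖Y - X₁‖ - ‖Y₁ - X₁‖),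
      mul_le_mul_of_nonneg_left (hA.norm_dir_sub_dir_le_two hX₁ hY hY₁) hC.le]
  have hXn := norm_mem_of_mem_Gam hc₁ hΩ hX
  linarith [norm_sub_le_norm_sub_add_norm_sub Y X₁ X, norm_sub_le X₁ X, hXn.2, hX₁n.2]

theorem HypA.exists_norm_sub_le (hA : HypA κ c₁ c₂ Ω T E s) (hc₁ : 0 < c₁)
    (hΩ : Ω ⊆ unitSphere n) :
    ∃ M > 0, ∀ X ∈ Gam c₁ c₂ Ω, ∀ Y ∈ T, ∀ Y' ∈ T,
      ‖Y - Y'‖ ≤ M * ‖dir (Y - X) - dir (Y' - X)‖ := by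
  obtain ⟨S, hS, hdist⟩ := hA.exists_dist_le hc₁ hΩ
  obtain ⟨C, hC, hlip⟩ := hA.lipschitz
  refine ⟨C + S, by positivity, fun X hX Y hY Y' hY' => ?_⟩
  have hs := hlip X hX _ (hA.dir_sub_mem hX hY) _ (hA.dir_sub_mem hX hY')
  rw [hA.apply_dir_sub hX hY, hA.apply_dir_sub hX hY'] at hs
  have hsplit : Y - Y' = (‖Y - X‖ - ‖Y' - X‖) • dir (Y - X) +
      ‖Y' - X‖ • (dir (Y - X) - dir (Y' - X)) := by
    rw [sub_smul, smul_sub, norm_smul_dir, norm_smul_dir]; abel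
  rw [hsplit]
  refine (norm_add_le _ _).trans ?_
  rw [norm_smul, norm_smul, hA.norm_eq_one hX (hA.dir_sub_mem hX hY), mul_one, norm_norm,
    Real.norm_eq_abs, add_mul]
  gcongr
  exact hdist X hX Y' hY'

end Target

section ReducedIncrement

variable {n : ℕ} {κ c₁ c₂ l : ℝ} {Ω T : Set (Space n)} {X₀ X Y Ybar Yhat : Space n}

/-- The increment of the optical length from `X₀` to `X`, multiplied by the conjugate factor
`κ |X - Y| + κ |Y - X₀| - (|X| - |X₀|)`, which removes the square roots, and divided by
`2 |Y - X₀|`. The result is affine in the pair formed by `1 / |Y - X₀|` and the direction of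
`Y - X₀`. -/
def reducedIncrement (κ : ℝ) (X₀ X Y : Space n) : ℝ :=
  (κ ^ 2 * ‖X - X₀‖ ^ 2 - (‖X‖ - ‖X₀‖) ^ 2) / 2 * ‖Y - X₀‖⁻¹ - κ ^ 2 * ⟪dir (Y - X₀), X - X₀⟫ +
    κ * (‖X‖ - ‖X₀‖)

theorem opticalLength_sub_mul_conj (κ : ℝ) (X : Space n) (hY : Y ≠ X₀) :
    (opticalLength κ Y X - opticalLength κ Y X₀) *
        (κ * ‖X - Y‖ + κ * ‖Y - X₀‖ - (‖X‖ - ‖X₀‖)) =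
      2 * ‖Y - X₀‖ * reducedIncrement κ X₀ X Y := by
  have ht : ‖Y - X₀‖ ≠ 0 := (norm_sub_pos_iff.2 hY).ne'
  have hcos : ‖X - Y‖ ^ 2 =
      ‖X - X₀‖ ^ 2 - 2 * (‖Y - X₀‖ * ⟪dir (Y - X₀), X - X₀⟫) + ‖Y - X₀‖ ^ 2 := by
    rw [← sub_sub_sub_cancel_right X Y X₀, norm_sub_sq_real, ← real_inner_smul_left (dir _),
      norm_smul_dir, real_inner_comm]
  rw [opticalLength, opticalLength, norm_sub_rev X₀, reducedIncrement]
  field_simp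
  linear_combination κ ^ 2 * hcos

theorem norm_sub_sub_inner_dir (hX₀ : X₀ ≠ 0) (X : Space n) :
    (‖X‖ - ‖X₀‖) - ⟪dir X₀, X - X₀⟫ =
      (‖X - X₀‖ ^ 2 - (‖X‖ - ‖X₀‖) ^ 2) / (2 * ‖X₀‖) := by
  have h0 : ‖X₀‖ ≠ 0 := norm_ne_zero_iff.2 hX₀
  rw [dir, real_inner_smul_left, inner_sub_right, real_inner_self_eq_norm_sq, norm_sub_sq_real,
    real_inner_comm]
  field_simp
  ring

/-- The failure of the reduced increment to be `β` times an affine function along a curve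
`[m̄, m̂]_{x₀}`: the direction `m(λ) - x₀ / κ` is `β` times an affine function of `λ`. -/
theorem reducedIncrement_of_dir_eq_curvePt (hκ : κ ≠ 0) (hX₀ : X₀ ≠ 0) (X : Space n)
    (hY : dir (Y - X₀) = curvePt κ (dir X₀) (dir (Ybar - X₀)) (dir (Yhat - X₀)) l)
    {β : ℝ} (hβ : β = beta κ (dir X₀) (dir (Ybar - X₀)) (dir (Yhat - X₀)) l) :
    reducedIncrement κ X₀ X Y =
      β * ((1 - l) * reducedIncrement κ X₀ X Ybar + l * reducedIncrement κ X₀ X Yhat) +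
      ((κ ^ 2 * ‖X - X₀‖ ^ 2 - (‖X‖ - ‖X₀‖) ^ 2) / 2 *
          (‖Y - X₀‖⁻¹ - β * ((1 - l) * ‖Ybar - X₀‖⁻¹ + l * ‖Yhat - X₀‖⁻¹)) +
        (1 - β) * (κ * (‖X - X₀‖ ^ 2 - (‖X‖ - ‖X₀‖) ^ 2) / (2 * ‖X₀‖))) := by
  have hlin : κ * ⟪dir (Y - X₀), X - X₀⟫ = ⟪dir X₀, X - X₀⟫ + β *
      ((1 - l) * (κ * ⟪dir (Ybar - X₀), X - X₀⟫ - ⟪dir X₀, X - X₀⟫) +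
        l * (κ * ⟪dir (Yhat - X₀), X - X₀⟫ - ⟪dir X₀, X - X₀⟫)) := by
    rw [hY, curvePt, ← hβ, chord]
    simp only [inner_add_left, inner_sub_left, real_inner_smul_left]
    field_simp
    ring
  rw [mul_div_assoc κ, ← norm_sub_sub_inner_dir hX₀ X]
  unfold reducedIncrement
  linear_combination -κ * hlin

section Bounds

variable (hκ0 : 0 < κ) (hκ1 : κ < 1) (hc₁ : 0 < c₁) (hΩ : Ω ⊆ unitSphere n)
  (hfar : IsFar κ c₁ c₂ Ω T) (hX₀ : X₀ ∈ Gam c₁ c₂ Ω) (hX : X ∈ Gam c₁ c₂ Ω) (hY : Y ∈ T)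
include hc₁ hΩ hfar hX₀ hY

theorem IsFar.le_norm_sub (hκ1 : κ < 1) : c₁ ≤ ‖Y - X₀‖ := by
  have hX₀n := norm_mem_of_mem_Gam hc₁ hΩ hX₀
  exact hX₀n.1.trans <| hX₀n.2.trans <|
    (hfar X₀ hX₀ Y hY).trans (mul_le_of_le_one_left (norm_nonneg _) hκ1.le)

include hX hκ0

theorem IsFar.conj_pos : 0 < κ * ‖X - Y‖ + κ * ‖Y - X₀‖ - (‖X‖ - ‖X₀‖) := by
  have := mul_nonneg hκ0.le (norm_nonneg (X - Y))
  linarith [(norm_mem_of_mem_Gam hc₁ hΩ hX).2, (norm_mem_of_mem_Gam hc₁ hΩ hX₀).1,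
    hfar X₀ hX₀ Y hY]

include hκ1

omit hκ0 in
theorem IsFar.conj_le : κ * ‖X - Y‖ + κ * ‖Y - X₀‖ - (‖X‖ - ‖X₀‖) ≤ 6 * ‖Y - X₀‖ := by
  have hXn := norm_mem_of_mem_Gam hc₁ hΩ hX
  have hX₀n := norm_mem_of_mem_Gam hc₁ hΩ hX₀
  have hc₂ : c₂ ≤ ‖Y - X₀‖ :=
    (hfar X₀ hX₀ Y hY).trans (mul_le_of_le_one_left (norm_nonneg _) hκ1.le)
  have htri : ‖X - Y‖ ≤ 3 * ‖Y - X₀‖ := by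
    linarith [norm_sub_le_norm_sub_add_norm_sub X X₀ Y, norm_sub_le X X₀, norm_sub_rev X₀ Y, hXn.2,
      hX₀n.2]
  have hκXY : κ * ‖X - Y‖ ≤ ‖X - Y‖ := mul_le_of_le_one_left (norm_nonneg _) hκ1.le
  have hκYX : κ * ‖Y - X₀‖ ≤ ‖Y - X₀‖ := mul_le_of_le_one_left (norm_nonneg _) hκ1.le
  linarith [hXn.1, hX₀n.2, norm_nonneg (Y - X₀)]

theorem IsFar.neg_le_reducedIncrement {e : ℝ} (he : 0 ≤ e)
    (hinc : -e ≤ opticalLength κ Y X - opticalLength κ Y X₀) :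
    -(3 * e) ≤ reducedIncrement κ X₀ X Y := by
  have ht := hc₁.trans_le (hfar.le_norm_sub hc₁ hΩ hX₀ hY hκ1)
  have hpos := hfar.conj_pos hκ0 hc₁ hΩ hX₀ hX hY
  have hmul := mul_le_mul_of_nonneg_right hinc hpos.le
  rw [opticalLength_sub_mul_conj κ X (norm_sub_pos_iff.1 ht)] at hmul
  have hle := mul_le_mul_of_nonneg_left (hfar.conj_le hκ1 hc₁ hΩ hX₀ hX hY) he
  refine le_of_mul_le_mul_left ?_ (show 0 < 2 * ‖Y - X₀‖ by positivity)
  linarith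

theorem IsFar.le_opticalLength_sub {g : ℝ} (hg : 0 ≤ g)
    (hinc : 3 * g ≤ reducedIncrement κ X₀ X Y) :
    g ≤ opticalLength κ Y X - opticalLength κ Y X₀ := by
  have ht := hc₁.trans_le (hfar.le_norm_sub hc₁ hΩ hX₀ hY hκ1)
  refine le_of_mul_le_mul_right ?_ (hfar.conj_pos hκ0 hc₁ hΩ hX₀ hX hY)
  rw [opticalLength_sub_mul_conj κ X (norm_sub_pos_iff.1 ht)]
  calc g * (κ * ‖X - Y‖ + κ * ‖Y - X₀‖ - (‖X‖ - ‖X₀‖)) ≤ g * (6 * ‖Y - X₀‖) :=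
        mul_le_mul_of_nonneg_left (hfar.conj_le hκ1 hc₁ hΩ hX₀ hX hY) hg
    _ = 2 * ‖Y - X₀‖ * (3 * g) := by ring
    _ ≤ 2 * ‖Y - X₀‖ * reducedIncrement κ X₀ X Y := by gcongr

end Bounds

end ReducedIncrement

section ScalarDichotomy

variable {κ ρ w d δ β q Q : ℝ}

theorem mul_le_sub_of_lt_sq (hκ1 : κ < 1) (hw : 0 ≤ w) (hdw : d ≤ w) (hd : -(κ * w) ≤ d)
    (hδ : 0 ≤ δ) (h : κ ^ 2 * w ^ 2 + 2 * δ * w ^ 2 < d ^ 2) : δ * w ≤ d - κ * w := by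
  by_contra! hlt
  have hκw : κ * w ≤ w := mul_le_of_le_one_left hw hκ1.le
  have hle : (d - κ * w) * (d + κ * w) ≤ δ * w * (2 * w) :=
    mul_le_mul hlt.le (by linarith) (by linarith) (by positivity)
  linarith

theorem mul_sq_le_gain_of_sq_le (hκ0 : 0 < κ) (hρ : 0 < ρ) (hβ : 0 ≤ 1 - β)
    (hδ0 : 0 ≤ δ) (hδ : δ ≤ (1 - κ ^ 2) / 4) (hQ : 0 ≤ Q) (hlow : -((1 - β) * (κ / ρ)) ≤ q)
    (hup : q ≤ Q) (h : d ^ 2 ≤ κ ^ 2 * w ^ 2 + 2 * δ * w ^ 2) :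
    ((1 - β) * (κ * (1 - κ ^ 2) / (4 * ρ)) - δ * Q) * w ^ 2 ≤
      (κ ^ 2 * w ^ 2 - d ^ 2) / 2 * q + (1 - β) * (κ * (w ^ 2 - d ^ 2) / (2 * ρ)) := by
  have hk : 0 ≤ 1 - κ ^ 2 := by linarith
  have hcoef : 0 ≤ (1 - β) * (κ / ρ) := by positivity
  have hsplit : (1 - β) * (κ * (1 - κ ^ 2) / (4 * ρ)) = (1 - β) * (κ / ρ) * ((1 - κ ^ 2) / 4) := by
    field_simp
  have hsplit' : (1 - β) * (κ * (w ^ 2 - d ^ 2) / (2 * ρ)) =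
      (1 - β) * (κ / ρ) * ((w ^ 2 - d ^ 2) / 2) := by
    field_simp
  rw [hsplit, hsplit', sub_mul]
  rcases le_total (d ^ 2) (κ ^ 2 * w ^ 2) with hA | hA
  · have hq := mul_le_mul_of_nonneg_left hlow (show 0 ≤ (κ ^ 2 * w ^ 2 - d ^ 2) / 2 by linarith)
    have hrest : 0 ≤ (1 - β) * (κ / ρ) * (1 - κ ^ 2) * w ^ 2 := by positivity
    have hQw : 0 ≤ δ * Q * w ^ 2 := by positivity
    linarith
  · have hq := mul_le_mul_of_nonneg_left hup (show 0 ≤ (d ^ 2 - κ ^ 2 * w ^ 2) / 2 by linarith)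
    have hQw := mul_le_mul_of_nonneg_right
      (show (d ^ 2 - κ ^ 2 * w ^ 2) / 2 ≤ δ * w ^ 2 by linarith) hQ
    have hδw := mul_le_mul_of_nonneg_right hδ (sq_nonneg w)
    have hgap := mul_le_mul_of_nonneg_left
      (show (1 - κ ^ 2) / 4 * w ^ 2 ≤ (w ^ 2 - d ^ 2) / 2 by linarith) hcoef
    linarith

end ScalarDichotomy

section TargetCurve

/-- The coefficient `β(λ)` of the curve `[Ȳ, Ŷ]_{X₀}` on the target. -/
def targetBeta {n : ℕ} (κ : ℝ) (X₀ Ybar Yhat : Space n) (l : ℝ) : ℝ :=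
  beta κ (dir X₀) (dir (Ybar - X₀)) (dir (Yhat - X₀)) l

/-- The amount by which `1 / |Y(λ) - X₀|` exceeds `β(λ)` times its linear interpolation between the
endpoints of the curve `[Ȳ, Ŷ]_{X₀}`. -/
def invDistGap {n : ℕ} (κ : ℝ) (s : Space n → Space n → ℝ) (X₀ Ybar Yhat : Space n) (l : ℝ) : ℝ :=
  ‖targetCurvePt κ s X₀ Ybar Yhat l - X₀‖⁻¹ -
    targetBeta κ X₀ Ybar Yhat l * ((1 - l) * ‖Ybar - X₀‖⁻¹ + l * ‖Yhat - X₀‖⁻¹)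

theorem inv_sub_inv_le_abs_sub_div_sq {a b r : ℝ} (hr : 0 < r) (ha : r ≤ a) (hb : r ≤ b) :
    a⁻¹ - b⁻¹ ≤ |a - b| / r ^ 2 := by
  have ha0 := hr.trans_le ha
  have hb0 := hr.trans_le hb
  calc a⁻¹ - b⁻¹ = (b - a) / (a * b) := by field_simp
    _ ≤ |a - b| / (a * b) := by gcongr; rw [abs_sub_comm]; exact le_abs_self _
    _ ≤ |a - b| / r ^ 2 := by rw [sq]; gcongr

variable {n : ℕ} {κ c₁ c₂ l : ℝ} {Ω T : Set (Space n)} {E : Space n → Set (Space n)}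
  {s : Space n → Space n → ℝ} {X₀ Ybar Yhat : Space n} (hA : HypA κ c₁ c₂ Ω T E s)
  (hX₀ : X₀ ∈ Gam c₁ c₂ Ω) (hbar : Ybar ∈ T) (hhat : Yhat ∈ T)
include hA hX₀ hbar hhat

theorem HypA.dir_targetCurvePt_sub (hl : l ∈ Set.Icc (0 : ℝ) 1) :
    dir (targetCurvePt κ s X₀ Ybar Yhat l - X₀) =
      curvePt κ (dir X₀) (dir (Ybar - X₀)) (dir (Yhat - X₀)) l := by
  have hm := hA.curvePt_mem hX₀ hbar hhat hl
  rw [targetCurvePt, add_sub_cancel_left,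
    dir_smul_unit (hA.pos X₀ hX₀ _ hm) (hA.norm_eq_one hX₀ hm)]

variable (hκ0 : 0 < κ) (hκ1 : κ < 1) (hc₁ : 0 < c₁) (hΩ : Ω ⊆ unitSphere n)
include hκ0 hκ1 hc₁ hΩ

theorem HypA.targetBeta_mem_Icc (hl : l ∈ Set.Icc (0 : ℝ) 1) :
    targetBeta κ X₀ Ybar Yhat l ∈ Set.Icc (0 : ℝ) 1 := by
  have hx₀ := norm_dir (ne_zero_of_mem_Gam hc₁ hΩ hX₀)
  have hc := norm_chord_le_one (hA.norm_eq_one hX₀ (hA.dir_sub_mem hX₀ hbar))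
    (hA.norm_eq_one hX₀ (hA.dir_sub_mem hX₀ hhat)) hl
  exact ⟨beta_nonneg hκ0 hκ1 hx₀ hc, beta_le_one hκ0 hκ1 hx₀ hc⟩

theorem HypA.mul_sq_le_one_sub_targetBeta (hl : l ∈ Set.Icc (1 / 4 : ℝ) (3 / 4)) :
    3 * κ / 64 * ‖dir (Ybar - X₀) - dir (Yhat - X₀)‖ ^ 2 ≤ 1 - targetBeta κ X₀ Ybar Yhat l := by
  have hl01 : l ∈ Set.Icc (0 : ℝ) 1 := Set.Icc_subset_Icc (by norm_num) (by norm_num) hl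
  have hmid : 3 / 16 ≤ l * (1 - l) := by
    linarith [mul_nonneg (sub_nonneg.2 hl.1) (sub_nonneg.2 hl.2)]
  have hle := mul_norm_sub_sq_le_one_sub_beta hκ0 hκ1 (norm_dir (ne_zero_of_mem_Gam hc₁ hΩ hX₀))
    (hA.norm_eq_one hX₀ (hA.dir_sub_mem hX₀ hbar)) (hA.norm_eq_one hX₀ (hA.dir_sub_mem hX₀ hhat))
    hl01
  have hβ := (hA.targetBeta_mem_Icc hX₀ hbar hhat hκ0 hκ1 hc₁ hΩ hl01).2
  have hκ : 2 * κ * (κ⁻¹ + 1) ≤ 4 := by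
    field_simp
    linarith
  calc 3 * κ / 64 * ‖dir (Ybar - X₀) - dir (Yhat - X₀)‖ ^ 2
      = κ / 4 * (3 / 16 * ‖dir (Ybar - X₀) - dir (Yhat - X₀)‖ ^ 2) := by ring
    _ ≤ κ / 4 * (2 * (κ⁻¹ + 1) * (1 - targetBeta κ X₀ Ybar Yhat l)) :=
        mul_le_mul_of_nonneg_left
          ((mul_le_mul_of_nonneg_right hmid (sq_nonneg _)).trans hle) (by positivity)
    _ = (2 * κ * (κ⁻¹ + 1)) / 4 * (1 - targetBeta κ X₀ Ybar Yhat l) := by ring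
    _ ≤ 1 - targetBeta κ X₀ Ybar Yhat l := mul_le_of_le_one_left (by linarith) (by linarith)

theorem HypA.one_sub_targetBeta_le (hl : l ∈ Set.Icc (0 : ℝ) 1) :
    1 - targetBeta κ X₀ Ybar Yhat l ≤
      (κ⁻¹ - 1)⁻¹ * ‖dir (Ybar - X₀) - dir (Yhat - X₀)‖ :=
  have hbarE := hA.dir_sub_mem hX₀ hbar
  have hhatE := hA.dir_sub_mem hX₀ hhat
  one_sub_beta_le hκ0 hκ1 (norm_dir (ne_zero_of_mem_Gam hc₁ hΩ hX₀)) (hA.norm_eq_one hX₀ hbarE)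
    (hA.norm_eq_one hX₀ hhatE) hl (hA.directions X₀ hX₀ hbarE).2 (hA.directions X₀ hX₀ hhatE).2

theorem HypA.norm_dir_targetCurvePt_sub_left_le (hl : l ∈ Set.Icc (0 : ℝ) 1) :
    ‖dir (targetCurvePt κ s X₀ Ybar Yhat l - X₀) - dir (Ybar - X₀)‖ ≤
      2 * ‖dir (Ybar - X₀) - dir (Yhat - X₀)‖ := by
  have hbarE := hA.dir_sub_mem hX₀ hbar
  have hhatE := hA.dir_sub_mem hX₀ hhat
  rw [hA.dir_targetCurvePt_sub hX₀ hbar hhat hl]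
  exact norm_curvePt_sub_left_le hκ0 hκ1 (norm_dir (ne_zero_of_mem_Gam hc₁ hΩ hX₀))
    (hA.norm_eq_one hX₀ hbarE) (hA.norm_eq_one hX₀ hhatE) hl (hA.directions X₀ hX₀ hbarE).2
    (hA.directions X₀ hX₀ hhatE).2

theorem HypA.norm_dir_targetCurvePt_sub_right_le (hl : l ∈ Set.Icc (0 : ℝ) 1) :
    ‖dir (targetCurvePt κ s X₀ Ybar Yhat l - X₀) - dir (Yhat - X₀)‖ ≤
      2 * ‖dir (Ybar - X₀) - dir (Yhat - X₀)‖ := by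
  have hbarE := hA.dir_sub_mem hX₀ hbar
  have hhatE := hA.dir_sub_mem hX₀ hhat
  rw [hA.dir_targetCurvePt_sub hX₀ hbar hhat hl]
  exact norm_curvePt_sub_right_le hκ0 hκ1 (norm_dir (ne_zero_of_mem_Gam hc₁ hΩ hX₀))
    (hA.norm_eq_one hX₀ hbarE) (hA.norm_eq_one hX₀ hhatE) hl (hA.directions X₀ hX₀ hbarE).2
    (hA.directions X₀ hX₀ hhatE).2

end TargetCurve

section InvDistGap

variable {n : ℕ} {κ c₁ c₂ : ℝ} {Ω T : Set (Space n)} {E : Space n → Set (Space n)}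
  {s : Space n → Space n → ℝ} (hA : HypA κ c₁ c₂ Ω T E s) (hκ0 : 0 < κ) (hκ1 : κ < 1)
  (hc₁ : 0 < c₁) (hΩ : Ω ⊆ unitSphere n)
include hA hκ1 hc₁ hΩ

theorem HypA.exists_inv_dist_sub_le (hfar : IsFar κ c₁ c₂ Ω T) :
    ∃ C > 0, ∀ X ∈ Gam c₁ c₂ Ω, ∀ Y ∈ T, ∀ Y' ∈ T,
      ‖Y - X‖⁻¹ - ‖Y' - X‖⁻¹ ≤ C * ‖dir (Y - X) - dir (Y' - X)‖ := by
  obtain ⟨C, hC, hlip⟩ := hA.lipschitz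
  refine ⟨C / c₁ ^ 2, by positivity, fun X hX Y hY Y' hY' => ?_⟩
  have hs := hlip X hX _ (hA.dir_sub_mem hX hY) _ (hA.dir_sub_mem hX hY')
  rw [hA.apply_dir_sub hX hY, hA.apply_dir_sub hX hY'] at hs
  calc ‖Y - X‖⁻¹ - ‖Y' - X‖⁻¹ ≤ |‖Y - X‖ - ‖Y' - X‖| / c₁ ^ 2 :=
        inv_sub_inv_le_abs_sub_div_sq hc₁ (hfar.le_norm_sub hc₁ hΩ hX hY hκ1)
          (hfar.le_norm_sub hc₁ hΩ hX hY' hκ1)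
    _ ≤ C * ‖dir (Y - X) - dir (Y' - X)‖ / c₁ ^ 2 := by gcongr
    _ = C / c₁ ^ 2 * ‖dir (Y - X) - dir (Y' - X)‖ := by ring

include hκ0

theorem HypC.le_invDistGap (hC : HypC κ c₁ c₂ Ω E s) {X₀ Ybar Yhat : Space n}
    (hX₀ : X₀ ∈ Gam c₁ c₂ Ω) (hbar : Ybar ∈ T) (hhat : Yhat ∈ T) {l : ℝ}
    (hl : l ∈ Set.Icc (0 : ℝ) 1) :
    -((1 - targetBeta κ X₀ Ybar Yhat l) * (κ / ‖X₀‖)) ≤ invDistGap κ s X₀ Ybar Yhat l := by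
  obtain ⟨μ, -, hμκ, hconc⟩ := hC
  have hle := hconc X₀ hX₀ _ (hA.dir_sub_mem hX₀ hbar) _ (hA.dir_sub_mem hX₀ hhat) l hl
  rw [hA.apply_dir_sub hX₀ hbar, hA.apply_dir_sub hX₀ hhat,
    ← hA.dir_targetCurvePt_sub hX₀ hbar hhat hl,
    hA.apply_dir_sub hX₀ (hA.targetCurvePt_mem hX₀ hbar hhat hl), one_div, one_div, one_div] at hle
  have hβ := (hA.targetBeta_mem_Icc hX₀ hbar hhat hκ0 hκ1 hc₁ hΩ hl).2
  have hμ := mul_le_mul_of_nonneg_left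
    (div_le_div_of_nonneg_right hμκ.le (norm_nonneg X₀)) (sub_nonneg.2 hβ)
  rw [targetBeta] at hμ ⊢
  rw [invDistGap, targetBeta]
  linarith

theorem HypA.exists_invDistGap_le (hfar : IsFar κ c₁ c₂ Ω T) :
    ∃ C > 0, ∀ X₀ ∈ Gam c₁ c₂ Ω, ∀ Ybar ∈ T, ∀ Yhat ∈ T, ∀ l ∈ Set.Icc (0 : ℝ) 1,
      invDistGap κ s X₀ Ybar Yhat l ≤ C * ‖dir (Ybar - X₀) - dir (Yhat - X₀)‖ := by
  obtain ⟨C, hC, hinvdist⟩ := hA.exists_inv_dist_sub_le hκ1 hc₁ hΩ hfar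
  have hinv : 0 < κ⁻¹ - 1 := sub_pos.2 ((one_lt_inv₀ hκ0).2 hκ1)
  refine ⟨2 * C + (κ⁻¹ - 1)⁻¹ * c₁⁻¹, by positivity, fun X₀ hX₀ Ybar hbar Yhat hhat l hl => ?_⟩
  have hl1 : 0 ≤ 1 - l := sub_nonneg.2 hl.2
  have hmem := hA.targetCurvePt_mem hX₀ hbar hhat hl
  set Y := targetCurvePt κ s X₀ Ybar Yhat l with hY
  set τ := ‖dir (Ybar - X₀) - dir (Yhat - X₀)‖
  set β := targetBeta κ X₀ Ybar Yhat l with hβ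
  have hleft : ‖Y - X₀‖⁻¹ - ‖Ybar - X₀‖⁻¹ ≤ C * (2 * τ) := by
    grw [hinvdist X₀ hX₀ Y hmem Ybar hbar,
      hA.norm_dir_targetCurvePt_sub_left_le hX₀ hbar hhat hκ0 hκ1 hc₁ hΩ hl]
  have hright : ‖Y - X₀‖⁻¹ - ‖Yhat - X₀‖⁻¹ ≤ C * (2 * τ) := by
    grw [hinvdist X₀ hX₀ Y hmem Yhat hhat,
      hA.norm_dir_targetCurvePt_sub_right_le hX₀ hbar hhat hκ0 hκ1 hc₁ hΩ hl]
  have hends : (1 - l) * ‖Ybar - X₀‖⁻¹ + l * ‖Yhat - X₀‖⁻¹ ≤ c₁⁻¹ := by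
    have hinvle : ∀ Y' ∈ T, ‖Y' - X₀‖⁻¹ ≤ c₁⁻¹ := fun Y' hY' =>
      inv_anti₀ hc₁ (hfar.le_norm_sub hc₁ hΩ hX₀ hY' hκ1)
    linarith [mul_le_mul_of_nonneg_left (hinvle Ybar hbar) hl1,
      mul_le_mul_of_nonneg_left (hinvle Yhat hhat) hl.1]
  have hβle : (1 - β) * ((1 - l) * ‖Ybar - X₀‖⁻¹ + l * ‖Yhat - X₀‖⁻¹) ≤
      (κ⁻¹ - 1)⁻¹ * τ * c₁⁻¹ :=
    mul_le_mul (hA.one_sub_targetBeta_le hX₀ hbar hhat hκ0 hκ1 hc₁ hΩ hl) hends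
      (add_nonneg (mul_nonneg hl1 (by positivity)) (mul_nonneg hl.1 (by positivity)))
      (by positivity)
  rw [invDistGap, ← hY, ← hβ]
  linarith [mul_le_mul_of_nonneg_left hleft hl1, mul_le_mul_of_nonneg_left hright hl.1]

end InvDistGap

section MaximumPrinciple

variable {n : ℕ} {κ c₁ c₂ : ℝ} {Ω T : Set (Space n)} {E : Space n → Set (Space n)}
  {s : Space n → Space n → ℝ} (hA : HypA κ c₁ c₂ Ω T E s) (hC : HypC κ c₁ c₂ Ω E s)
  (hfar : IsFar κ c₁ c₂ Ω T) (hκ0 : 0 < κ) (hκ1 : κ < 1) (hc₁ : 0 < c₁) (hΩ : Ω ⊆ unitSphere n)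
include hA hC hfar hκ0 hκ1 hc₁ hΩ

/-- Either the polar radius grows fast enough from `X₀` to `X`, or the concavity of `1 / s` makes
the reduced increment at `Y(λ)` exceed its interpolation by a quadratic amount. -/
theorem HypA.exists_growth_or_gain :
    ∃ c > 0, ∀ X₀ ∈ Gam c₁ c₂ Ω, ∀ X : Space n, -(κ * ‖X - X₀‖) ≤ ‖X‖ - ‖X₀‖ →
      ∀ Ybar ∈ T, ∀ Yhat ∈ T, ∀ l ∈ Set.Icc (1 / 4 : ℝ) (3 / 4),
        c * ‖dir (Ybar - X₀) - dir (Yhat - X₀)‖ * ‖X - X₀‖ ≤ ‖X‖ - ‖X₀‖ - κ * ‖X - X₀‖ ∨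
        c * ‖dir (Ybar - X₀) - dir (Yhat - X₀)‖ ^ 2 * ‖X - X₀‖ ^ 2 ≤
          reducedIncrement κ X₀ X (targetCurvePt κ s X₀ Ybar Yhat l) -
            targetBeta κ X₀ Ybar Yhat l *
              ((1 - l) * reducedIncrement κ X₀ X Ybar + l * reducedIncrement κ X₀ X Yhat) := by
  obtain ⟨C, hC0, hgap⟩ := hA.exists_invDistGap_le hκ0 hκ1 hc₁ hΩ hfar
  rcases (Gam c₁ c₂ Ω).eq_empty_or_nonempty with hG | ⟨X₁, hX₁⟩
  · exact ⟨1, one_pos, by simp [hG]⟩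
  have hc₂ : 0 < c₂ :=
    hc₁.trans_le ((norm_mem_of_mem_Gam hc₁ hΩ hX₁).1.trans (norm_mem_of_mem_Gam hc₁ hΩ hX₁).2)
  have hk : 0 < 1 - κ ^ 2 := sub_pos.2 (pow_lt_one₀ hκ0.le hκ1 two_ne_zero)
  set g := 3 * κ / 64 * (κ * (1 - κ ^ 2) / (4 * c₂)) with hg
  have hg0 : 0 < g := by positivity
  obtain ⟨c, hc0, hc8, hcg⟩ : ∃ c > 0, c ≤ (1 - κ ^ 2) / 8 ∧ c ≤ g / (1 + C) :=
    ⟨_, lt_min (by positivity) (by positivity), min_le_left _ _, min_le_right _ _⟩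
  rw [le_div_iff₀ (by positivity)] at hcg
  refine ⟨c, hc0, fun X₀ hX₀ X hd Ybar hbar Yhat hhat l hl => ?_⟩
  have hl01 : l ∈ Set.Icc (0 : ℝ) 1 := Set.Icc_subset_Icc (by norm_num) (by norm_num) hl
  have hX₀n := norm_mem_of_mem_Gam hc₁ hΩ hX₀
  have hρ : 0 < ‖X₀‖ := hc₁.trans_le hX₀n.1
  have hτ2 := hA.norm_dir_sub_dir_le_two hX₀ hbar hhat
  have hβ := hA.mul_sq_le_one_sub_targetBeta hX₀ hbar hhat hκ0 hκ1 hc₁ hΩ hl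
  have hβ0 : 0 ≤ 1 - targetBeta κ X₀ Ybar Yhat l := le_trans (by positivity) hβ
  have hlow := hC.le_invDistGap hA hκ0 hκ1 hc₁ hΩ hX₀ hbar hhat hl01
  have hup := hgap X₀ hX₀ Ybar hbar Yhat hhat l hl01
  rw [reducedIncrement_of_dir_eq_curvePt hκ0.ne' (norm_pos_iff.1 hρ) X
    (hA.dir_targetCurvePt_sub hX₀ hbar hhat hl01) rfl, ← targetBeta, add_sub_cancel_left,
    ← invDistGap]
  set τ := ‖dir (Ybar - X₀) - dir (Yhat - X₀)‖
  have hτ0 : 0 ≤ τ := norm_nonneg _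
  rcases lt_or_ge (κ ^ 2 * ‖X - X₀‖ ^ 2 + 2 * (c * τ) * ‖X - X₀‖ ^ 2) ((‖X‖ - ‖X₀‖) ^ 2) with
    hfast | hslow
  · exact .inl <| mul_le_sub_of_lt_sq hκ1 (norm_nonneg _)
      ((le_abs_self _).trans (abs_norm_sub_norm_le X X₀)) hd (by positivity) hfast
  · refine .inr (le_trans ?_ (mul_sq_le_gain_of_sq_le hκ0 hρ hβ0 (by positivity)
      (by linarith [mul_le_mul hc8 hτ2 hτ0 (by positivity)]) (by positivity) hlow hup hslow))
    refine mul_le_mul_of_nonneg_right (le_sub_iff_add_le.2 ?_) (sq_nonneg _)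
    calc c * τ ^ 2 + c * τ * (C * τ) = c * (1 + C) * τ ^ 2 := by ring
      _ ≤ g * τ ^ 2 := by grw [hcg]
      _ = 3 * κ / 64 * τ ^ 2 * (κ * (1 - κ ^ 2) / (4 * c₂)) := by rw [hg]; ring
      _ ≤ (1 - targetBeta κ X₀ Ybar Yhat l) * (κ * (1 - κ ^ 2) / (4 * ‖X₀‖)) := by
          grw [hβ, hX₀n.2]

theorem HypA.exists_angular_maximum_principle :
    ∃ c > 0, ∀ X₀ ∈ Gam c₁ c₂ Ω, ∀ X ∈ Gam c₁ c₂ Ω, ∀ Ybar ∈ T, ∀ Yhat ∈ T,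
      ∀ l ∈ Set.Icc (1 / 4 : ℝ) (3 / 4), ∀ e : ℝ, 0 ≤ e →
      opticalLength κ Ybar X₀ ≤ opticalLength κ Ybar X →
      opticalLength κ Yhat X₀ - e ≤ opticalLength κ Yhat X →
      e ≤ c * ‖dir (Ybar - X₀) - dir (Yhat - X₀)‖ ^ 2 * ‖X - X₀‖ ^ 2 →
      c * ‖dir (Ybar - X₀) - dir (Yhat - X₀)‖ ^ 2 * ‖X - X₀‖ ^ 2 ≤
        opticalLength κ (targetCurvePt κ s X₀ Ybar Yhat l) X -
          opticalLength κ (targetCurvePt κ s X₀ Ybar Yhat l) X₀ := by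
  obtain ⟨C, hC0, hdich⟩ := hA.exists_growth_or_gain hC hfar hκ0 hκ1 hc₁ hΩ
  rcases (Gam c₁ c₂ Ω).eq_empty_or_nonempty with hG | ⟨X₁, hX₁⟩
  · exact ⟨1, one_pos, by simp [hG]⟩
  have hc₂ : 0 < c₂ :=
    hc₁.trans_le ((norm_mem_of_mem_Gam hc₁ hΩ hX₁).1.trans (norm_mem_of_mem_Gam hc₁ hΩ hX₁).2)
  obtain ⟨c, hc0, hc6, hcg⟩ : ∃ c > 0, c ≤ C / 6 ∧ c ≤ C / (4 * c₂) :=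
    ⟨_, lt_min (by positivity) (by positivity), min_le_left _ _, min_le_right _ _⟩
  rw [le_div_iff₀ (by positivity)] at hcg
  refine ⟨c, hc0, fun X₀ hX₀ X hX Ybar hbar Yhat hhat l hl e he hGbar hGhat hle => ?_⟩
  have hl01 : l ∈ Set.Icc (0 : ℝ) 1 := Set.Icc_subset_Icc (by norm_num) (by norm_num) hl
  have hmem := hA.targetCurvePt_mem hX₀ hbar hhat hl01
  have hdbar := abs_le.1 (abs_opticalLength_sub_sub_le hκ0.le Ybar X X₀)
  have hτ2 := hA.norm_dir_sub_dir_le_two hX₀ hbar hhat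
  have hβ := hA.targetBeta_mem_Icc hX₀ hbar hhat hκ0 hκ1 hc₁ hΩ hl01
  specialize hdich X₀ hX₀ X (by linarith) Ybar hbar Yhat hhat l hl
  set τ := ‖dir (Ybar - X₀) - dir (Yhat - X₀)‖
  have hτ0 : 0 ≤ τ := norm_nonneg _
  rcases hdich with hgrowth | hgain
  · have hw : ‖X - X₀‖ ≤ 2 * c₂ := (norm_sub_le _ _).trans <| by
      linarith [(norm_mem_of_mem_Gam hc₁ hΩ hX).2, (norm_mem_of_mem_Gam hc₁ hΩ hX₀).2]
    calc c * τ ^ 2 * ‖X - X₀‖ ^ 2 = c * τ * ‖X - X₀‖ * (τ * ‖X - X₀‖) := by ring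
      _ ≤ c * τ * ‖X - X₀‖ * (2 * (2 * c₂)) := by gcongr
      _ = c * (4 * c₂) * τ * ‖X - X₀‖ := by ring
      _ ≤ C * τ * ‖X - X₀‖ := by grw [hcg]
      _ ≤ _ := by
        linarith [(abs_le.1 (abs_opticalLength_sub_sub_le hκ0.le
          (targetCurvePt κ s X₀ Ybar Yhat l) X X₀)).1]
  · refine hfar.le_opticalLength_sub hκ0 hκ1 hc₁ hΩ hX₀ hX hmem (by positivity) ?_
    have hPbar := hfar.neg_le_reducedIncrement hκ0 hκ1 hc₁ hΩ hX₀ hX hbar le_rfl (by linarith)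
    have hPhat := hfar.neg_le_reducedIncrement hκ0 hκ1 hc₁ hΩ hX₀ hX hhat he (by linarith)
    have hinterp : -(3 * e) ≤ (1 - l) * reducedIncrement κ X₀ X Ybar +
        l * reducedIncrement κ X₀ X Yhat := by
      nlinarith [mul_nonneg (sub_nonneg.2 hl01.2) (neg_le_iff_add_nonneg.1 hPbar),
        mul_le_mul_of_nonneg_left hPhat hl01.1, mul_nonneg (sub_nonneg.2 hl01.2) he]
    have hβinterp := mul_le_mul_of_nonneg_left hinterp hβ.1
    have hβe := mul_le_mul_of_nonneg_right hβ.2 he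
    have hCc : 6 * c * (τ ^ 2 * ‖X - X₀‖ ^ 2) ≤ C * (τ ^ 2 * ‖X - X₀‖ ^ 2) := by
      gcongr
      linarith
    linarith

/-- The quantitative maximum principle: if the optical lengths to `Ȳ` and, up to the error `e`, to
`Ŷ` do not decrease from `X₀` to `X`, then those to the middle points of `[Ȳ, Ŷ]_{X₀}` increase by a
quadratic amount. -/
theorem HypA.exists_maximum_principle :
    ∃ c > 0, ∀ X₀ ∈ Gam c₁ c₂ Ω, ∀ X ∈ Gam c₁ c₂ Ω, ∀ Ybar ∈ T, ∀ Yhat ∈ T,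
      ∀ l ∈ Set.Icc (1 / 4 : ℝ) (3 / 4), ∀ e : ℝ, 0 ≤ e →
      opticalLength κ Ybar X₀ ≤ opticalLength κ Ybar X →
      opticalLength κ Yhat X₀ - e ≤ opticalLength κ Yhat X →
      e ≤ c * ‖Ybar - Yhat‖ ^ 2 * ‖X - X₀‖ ^ 2 →
      c * ‖Ybar - Yhat‖ ^ 2 * ‖X - X₀‖ ^ 2 ≤
        opticalLength κ (targetCurvePt κ s X₀ Ybar Yhat l) X -
          opticalLength κ (targetCurvePt κ s X₀ Ybar Yhat l) X₀ := by
  obtain ⟨c, hc, hmax⟩ := hA.exists_angular_maximum_principle hC hfar hκ0 hκ1 hc₁ hΩ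
  obtain ⟨M, hM, hdist⟩ := hA.exists_norm_sub_le hc₁ hΩ
  refine ⟨c / M ^ 2, by positivity,
    fun X₀ hX₀ X hX Ybar hbar Yhat hhat l hl e he hGbar hGhat hle => ?_⟩
  have hscale : c / M ^ 2 * ‖Ybar - Yhat‖ ^ 2 * ‖X - X₀‖ ^ 2 ≤
      c * ‖dir (Ybar - X₀) - dir (Yhat - X₀)‖ ^ 2 * ‖X - X₀‖ ^ 2 := by
    calc _ ≤ c / M ^ 2 * (M * ‖dir (Ybar - X₀) - dir (Yhat - X₀)‖) ^ 2 * ‖X - X₀‖ ^ 2 := by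
          grw [hdist X₀ hX₀ Ybar hbar Yhat hhat]
      _ = _ := by field_simp
  exact hscale.trans
    (hmax X₀ hX₀ X hX Ybar hbar Yhat hhat l hl e he hGbar hGhat (hle.trans hscale))

end MaximumPrinciple

section Refractor

/-- The point `u(x) x` of the surface with polar radius `u`. -/
def graphPt {n : ℕ} (u : Space n → ℝ) (x : Space n) : Space n := u x • x

variable {n : ℕ} {κ c₁ c₂ : ℝ} {Ω T : Set (Space n)} {u : Space n → ℝ}

theorem IsRefractor.graphPt_mem (hu : IsRefractor κ c₁ c₂ Ω T u) {x : Space n} (hx : x ∈ Ω) :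
    graphPt u x ∈ Gam c₁ c₂ Ω :=
  ⟨x, hx, u x, hu.1 x hx, rfl⟩

variable (hu : IsRefractor κ c₁ c₂ Ω T u) (hc₁ : 0 < c₁) (hΩ : Ω ⊆ unitSphere n)
include hu hc₁ hΩ

theorem IsRefractor.norm_graphPt {x : Space n} (hx : x ∈ Ω) : ‖graphPt u x‖ = u x := by
  rw [graphPt, norm_smul, norm_of_mem hΩ hx, mul_one,
    Real.norm_of_nonneg (hc₁.le.trans (hu.1 x hx).1)]

theorem IsRefractor.dir_graphPt {x : Space n} (hx : x ∈ Ω) : dir (graphPt u x) = x :=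
  dir_smul_unit (hc₁.trans_le (hu.1 x hx).1) (norm_of_mem hΩ hx)

theorem IsRefractor.norm_sub_le_norm_graphPt_sub {x y : Space n} (hx : x ∈ Ω) (hy : y ∈ Ω) :
    ‖x - y‖ ≤ 2 / c₁ * ‖graphPt u x - graphPt u y‖ := by
  have hX := ne_zero_of_mem_Gam hc₁ hΩ (hu.graphPt_mem hx)
  have hdir := norm_dir_sub_dir_le hX (graphPt u y)
  rw [hu.dir_graphPt hc₁ hΩ hx, hu.dir_graphPt hc₁ hΩ hy, hu.norm_graphPt hc₁ hΩ hx] at hdir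
  grw [hdir, (hu.1 x hx).1]

variable (hκ0 : 0 < κ) (hκ1 : κ < 1)
include hκ0 hκ1

/-- A supporting oval touches from inside, so touching it at `x₀` means minimizing the optical
length on the surface. -/
theorem IsRefractor.mem_subdiff_iff {x₀ Y : Space n} :
    Y ∈ subdiff κ Ω T u x₀ ↔ Y ∈ T ∧ ∀ x ∈ Ω,
      opticalLength κ Y (graphPt u x₀) ≤ opticalLength κ Y (graphPt u x) := by
  refine and_congr_right fun _ => forall₂_congr fun x hx => ?_
  rw [h, ovalRadius_le_iff hκ0.le hκ1 (norm_of_mem hΩ hx), opticalLength, opticalLength,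
    hu.norm_graphPt hc₁ hΩ hx]
  rfl

theorem IsRefractor.sub_le {x y : Space n} (hx : x ∈ Ω) (hy : y ∈ Ω) :
    u y - u x ≤ κ * c₂ / (1 - κ) * ‖x - y‖ := by
  obtain ⟨hux₁, hux₂⟩ := hu.1 x hx
  have hκ : 0 < 1 - κ := sub_pos.2 hκ1
  have hc₂ : 0 < c₂ := by linarith
  rcases le_total (u y) (u x) with hle | hle
  · exact (sub_nonpos.2 hle).trans (by positivity)
  obtain ⟨Y, hY⟩ := hu.2 y hy
  have hmin := ((hu.mem_subdiff_iff hc₁ hΩ hκ0 hκ1).1 hY).2 x hx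
  rw [opticalLength, opticalLength, hu.norm_graphPt hc₁ hΩ hx, hu.norm_graphPt hc₁ hΩ hy] at hmin
  have hray := slope_le_ray_sub hκ0.le (norm_of_mem hΩ hy) Y hle
  have hside : ‖graphPt u x - Y‖ ≤ c₂ * ‖x - y‖ + ‖u x • y - Y‖ :=
    calc
      _ = ‖u x • (x - y) + (u x • y - Y)‖ := by
        rw [graphPt]
        congr 1
        module
      _ ≤ u x * ‖x - y‖ + ‖u x • y - Y‖ := by
        grw [norm_add_le, norm_smul, Real.norm_of_nonneg (hc₁.le.trans hux₁)]
      _ ≤ _ := by gcongr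
  rw [div_mul_eq_mul_div, le_div_iff₀ hκ]
  linarith [mul_le_mul_of_nonneg_left hside hκ0.le, show κ * ‖graphPt u y - Y‖ =
    κ * ‖u y • y - Y‖ from rfl]

theorem IsRefractor.norm_graphPt_sub_le {x y : Space n} (hx : x ∈ Ω) (hy : y ∈ Ω) :
    ‖graphPt u x - graphPt u y‖ ≤ c₂ / (1 - κ) * ‖x - y‖ := by
  have hux : |u x - u y| ≤ κ * c₂ / (1 - κ) * ‖x - y‖ :=
    abs_sub_le_iff.2 ⟨norm_sub_rev x y ▸ hu.sub_le hc₁ hΩ hκ0 hκ1 hy hx,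
      hu.sub_le hc₁ hΩ hκ0 hκ1 hx hy⟩
  calc ‖graphPt u x - graphPt u y‖ = ‖u x • (x - y) + (u x - u y) • y‖ := by
        simp only [graphPt]
        congr 1
        module
    _ ≤ u x * ‖x - y‖ + |u x - u y| := by
        grw [norm_add_le, norm_smul, norm_smul, norm_of_mem hΩ hy, mul_one,
          Real.norm_of_nonneg (hc₁.le.trans (hu.1 x hx).1), Real.norm_eq_abs]
    _ ≤ c₂ * ‖x - y‖ + κ * c₂ / (1 - κ) * ‖x - y‖ := by grw [hux, (hu.1 x hx).2]
    _ = c₂ / (1 - κ) * ‖x - y‖ := by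
        have := (sub_pos.2 hκ1).ne'
        field_simp
        ring

theorem IsRefractor.continuousOn_graphPt : ContinuousOn (graphPt u) Ω := by
  refine (LipschitzOnWith.of_dist_le_mul (K := (c₂ / (1 - κ)).toNNReal)
    fun x hx y hy => ?_).continuousOn
  rw [dist_eq_norm, dist_eq_norm]
  exact (hu.norm_graphPt_sub_le hc₁ hΩ hκ0 hκ1 hx hy).trans
    (mul_le_mul_of_nonneg_right (Real.le_coe_toNNReal _) (norm_nonneg _))

/-- If the optical length to `Y` is no smaller outside a cap in `Ω` than at a point `x₀` of that
cap, then it attains its minimum in the cap. -/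
theorem IsRefractor.exists_mem_subdiff_of_le {A : Set (Space n)} (hA : IsCompact A) (hAΩ : A ⊆ Ω)
    {x₀ Y : Space n} (hx₀ : x₀ ∈ A) (hY : Y ∈ T)
    (hle : ∀ x ∈ Ω, x ∉ A → opticalLength κ Y (graphPt u x₀) ≤ opticalLength κ Y (graphPt u x)) :
    ∃ z ∈ A, Y ∈ subdiff κ Ω T u z := by
  have hcont : ContinuousOn (fun x => opticalLength κ Y (graphPt u x)) A :=
    (show Continuous (opticalLength κ Y) by unfold opticalLength; fun_prop).comp_continuousOn
      ((hu.continuousOn_graphPt hc₁ hΩ hκ0 hκ1).mono hAΩ)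
  obtain ⟨z, hz, hmin⟩ := hA.exists_isMinOn ⟨x₀, hx₀⟩ hcont
  refine ⟨z, hz, (hu.mem_subdiff_iff hc₁ hΩ hκ0 hκ1).2 ⟨hY, fun x hx => ?_⟩⟩
  by_cases hxA : x ∈ A
  · exact hmin hxA
  · exact (hmin hx₀).trans (hle x hx hxA)

end Refractor

section ImageOfCaps

variable {n : ℕ} {κ c₁ c₂ : ℝ} {Ω T : Set (Space n)} {E : Space n → Set (Space n)}
  {s : Space n → Space n → ℝ} {u : Space n → ℝ}

theorem IsFar.abs_mixed_opticalLength_le (hfar : IsFar κ c₁ c₂ Ω T) (hκ0 : 0 < κ) (hc₂ : 0 < c₂)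
    {X X' Y : Space n} (hX : X ∈ Gam c₁ c₂ Ω) (hX' : X' ∈ Gam c₁ c₂ Ω) (hY : Y ∈ T)
    (Y' : Space n) :
    |(opticalLength κ Y X - opticalLength κ Y X') - (opticalLength κ Y' X - opticalLength κ Y' X')|
      ≤ 2 * κ ^ 2 / c₂ * ‖X - X'‖ * ‖Y - Y'‖ := by
  have hdist : ∀ Z ∈ Gam c₁ c₂ Ω, c₂ / κ ≤ ‖Z - Y‖ := fun Z hZ => by
    rw [div_le_iff₀' hκ0, norm_sub_rev]
    exact hfar Z hZ Y hY
  calc _ = κ * |(‖X - Y‖ - ‖X' - Y‖) - (‖X - Y'‖ - ‖X' - Y'‖)| := by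
        rw [← abs_of_pos hκ0, ← abs_mul, abs_of_pos hκ0]
        unfold opticalLength
        congr 1
        ring
    _ ≤ κ * (2 / (c₂ / κ) * ‖X - X'‖ * ‖Y - Y'‖) := by
        grw [abs_mixed_dist_le (by positivity) (hdist X hX) (hdist X' hX')]
    _ = 2 * κ ^ 2 / c₂ * ‖X - X'‖ * ‖Y - Y'‖ := by field_simp

variable (hu : IsRefractor κ c₁ c₂ Ω T u) (hA : HypA κ c₁ c₂ Ω T E s) (hC : HypC κ c₁ c₂ Ω E s)
  (hfar : IsFar κ c₁ c₂ Ω T) (hκ0 : 0 < κ) (hκ1 : κ < 1) (hc₁ : 0 < c₁) (hc₂ : 0 < c₂)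
  (hΩ : Ω ⊆ unitSphere n)
include hu hA hC hfar hκ0 hκ1 hc₁ hc₂ hΩ

/-- The maximum principle on the surface: its gain absorbs both the failure of `Ŷ` to support at
`x̄` and the replacement of `Y(λ)` by a nearby point of the target. -/
theorem IsRefractor.exists_opticalLength_le_of_mem_thickening :
    ∃ C₁ > 0, ∃ a > 0, ∀ xbar ∈ Ω, ∀ xhat ∈ Ω, ∀ Ybar ∈ subdiff κ Ω T u xbar,
      ∀ Yhat ∈ subdiff κ Ω T u xhat, ∀ σ > 0, C₁ * ‖xbar - xhat‖ ≤ σ ^ 2 * ‖Ybar - Yhat‖ →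
      ∀ Y ∈ Metric.thickening (a * ‖Ybar - Yhat‖ ^ 2 * σ)
        (targetCurvePt κ s (graphPt u xbar) Ybar Yhat '' Set.Icc (1 / 4) (3 / 4)) ∩ T,
      ∀ x ∈ Ω, σ ≤ ‖graphPt u x - graphPt u xbar‖ →
        opticalLength κ Y (graphPt u xbar) ≤ opticalLength κ Y (graphPt u x) := by
  obtain ⟨c, hc, hmax⟩ := hA.exists_maximum_principle hC hfar hκ0 hκ1 hc₁ hΩ
  have hκ : 0 < 1 - κ := sub_pos.2 hκ1
  set M := 2 * κ ^ 2 / c₂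
  have hM : 0 < M := by positivity
  refine ⟨M * (c₂ / (1 - κ)) / c, by positivity, c / M, by positivity, ?_⟩
  rintro xbar hxbar xhat hxhat Ybar hYbar Yhat hYhat σ hσ hscale Y ⟨hYthick, hYT⟩ x hx hσx
  obtain ⟨_, ⟨l, hl, rfl⟩, hYl⟩ := Metric.mem_thickening_iff.1 hYthick
  rw [hu.mem_subdiff_iff hc₁ hΩ hκ0 hκ1] at hYbar hYhat
  have hX₀ := hu.graphPt_mem hxbar
  have hX := hu.graphPt_mem hx
  set Yl := targetCurvePt κ s (graphPt u xbar) Ybar Yhat l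
  set δ := ‖Ybar - Yhat‖
  set w := ‖graphPt u x - graphPt u xbar‖
  set e := M * (c₂ / (1 - κ) * ‖xbar - xhat‖) * δ
  have he : e ≤ c * δ ^ 2 * w ^ 2 :=
    calc
      _ = c * (M * (c₂ / (1 - κ)) / c * ‖xbar - xhat‖) * δ := by
        simp only [e]
        field_simp
      _ ≤ c * (w ^ 2 * δ) * δ := by grw [hscale, hσx]
      _ = c * δ ^ 2 * w ^ 2 := by ring
  have hsupport :
      opticalLength κ Yhat (graphPt u xbar) - e ≤ opticalLength κ Yhat (graphPt u x) := by
    have hmix := (abs_le.1 (hfar.abs_mixed_opticalLength_le hκ0 hc₂ hX₀ (hu.graphPt_mem hxhat)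
      hYbar.1 Yhat)).1
    have hlip : M * ‖graphPt u xbar - graphPt u xhat‖ * δ ≤ e := by
      grw [hu.norm_graphPt_sub_le hc₁ hΩ hκ0 hκ1 hxbar hxhat]
    linarith [hYbar.2 xhat hxhat, hYhat.2 x hx]
  have hgain := hmax _ hX₀ _ hX Ybar hYbar.1 Yhat hYhat.1 l hl e (by positivity) (hYbar.2 x hx)
    hsupport he
  have hmix := (abs_le.1 (hfar.abs_mixed_opticalLength_le hκ0 hc₂ hX hX₀ hYT Yl)).1
  have hnear : M * w * ‖Y - Yl‖ ≤ c * δ ^ 2 * w ^ 2 :=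
    calc M * w * ‖Y - Yl‖ ≤ M * w * (c / M * δ ^ 2 * w) := by grw [← dist_eq_norm, hYl, hσx]
      _ = c * δ ^ 2 * w ^ 2 := by field_simp
  linarith

theorem IsRefractor.exists_thickening_subset :
    ∃ C₁ > 0, ∃ a > 0, ∃ R > 0, ∀ xbar ∈ Ω, ∀ xhat ∈ Ω, ∀ Ybar ∈ subdiff κ Ω T u xbar,
      ∀ Yhat ∈ subdiff κ Ω T u xhat, ∀ σ > 0, C₁ * ‖xbar - xhat‖ ≤ σ ^ 2 * ‖Ybar - Yhat‖ →
      Metric.ball xbar (R * σ) ∩ unitSphere n ⊆ Ω →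
      Metric.thickening (a * ‖Ybar - Yhat‖ ^ 2 * σ)
          (targetCurvePt κ s (graphPt u xbar) Ybar Yhat '' Set.Icc (1 / 4) (3 / 4)) ∩ T ⊆
        ⋃ x ∈ Metric.ball xbar (R * σ) ∩ unitSphere n, subdiff κ Ω T u x := by
  obtain ⟨C₁, hC₁, a, ha, hle⟩ :=
    hu.exists_opticalLength_le_of_mem_thickening hA hC hfar hκ0 hκ1 hc₁ hc₂ hΩ
  refine ⟨C₁, hC₁, a, ha, 4 / c₁, by positivity,
    fun xbar hxbar xhat hxhat Ybar hYbar Yhat hYhat σ hσ hscale hball Y hY => ?_⟩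
  have hcap : Metric.closedBall xbar (2 / c₁ * σ) ∩ unitSphere n ⊆
      Metric.ball xbar (4 / c₁ * σ) ∩ unitSphere n := by
    refine Set.inter_subset_inter_left _ (Metric.closedBall_subset_ball ?_)
    gcongr
    norm_num
  have hout : ∀ x ∈ Ω, x ∉ Metric.closedBall xbar (2 / c₁ * σ) ∩ unitSphere n →
      σ ≤ ‖graphPt u x - graphPt u xbar‖ := fun x hx => by
    contrapose!
    refine fun hlt => ⟨?_, hΩ hx⟩
    rw [mem_closedBall_iff_norm]
    grw [hu.norm_sub_le_norm_graphPt_sub hc₁ hΩ hx hxbar, hlt]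
  obtain ⟨z, hz, hYz⟩ := hu.exists_mem_subdiff_of_le hc₁ hΩ hκ0 hκ1
    ((isCompact_closedBall _ _).inter_right Metric.isClosed_sphere) (hcap.trans hball)
    ⟨Metric.mem_closedBall_self (by positivity), hΩ hxbar⟩ hY.2 fun x hx hxcap =>
      hle xbar hxbar xhat hxhat Ybar hYbar Yhat hYhat σ hσ hscale Y hY x hx (hout x hx hxcap)
  exact Set.mem_biUnion (hcap hz) hYz

end ImageOfCaps

section HolderSubdiff

/-- The optimal scale is the smallest admissible one, `σ² = C₁ ε / δ`. It is available as long as it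
is less than `σ₀`; otherwise `δ` itself is bounded by a multiple of `ε`. -/
theorem pow_le_of_scale {k : ℕ} {δ M C₁ C₂ σ₀ ε : ℝ} (hδ : 0 < δ) (hδM : δ ≤ M) (hC₁ : 0 ≤ C₁)
    (hσ₀ : 0 < σ₀) (hε : 0 ≤ ε)
    (h : ∀ σ, 0 < σ → σ ≤ σ₀ → C₁ * ε ≤ σ ^ 2 * δ → δ ^ (2 * k + 1) ≤ C₂ * σ) :
    δ ^ (4 * k + 3) ≤ (C₂ ^ 2 * C₁ + M ^ (4 * k + 2) * (C₁ / σ₀ ^ 2)) * ε := by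
  set τ := √(C₁ * ε / δ)
  have hτ : τ ^ 2 = C₁ * ε / δ := Real.sq_sqrt (by positivity)
  have hM : 0 < M := hδ.trans_le hδM
  rw [add_mul]
  rcases lt_or_ge τ σ₀ with hlt | hle
  · have hlim : δ ^ (2 * k + 1) ≤ C₂ * τ := by
      refine ge_of_tendsto ((continuous_const_mul C₂).tendsto τ |>.mono_left
        (nhdsWithin_le_nhds (s := Set.Ioi τ))) ?_
      filter_upwards [Ioc_mem_nhdsGT hlt] with σ hσ
      have hτσ : τ ^ 2 ≤ σ ^ 2 := pow_le_pow_left₀ (Real.sqrt_nonneg _) hσ.1.le 2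
      exact h σ ((Real.sqrt_nonneg _).trans_lt hσ.1) hσ.2
        (by rwa [← div_le_iff₀ hδ, ← hτ])
    refine le_add_of_le_of_nonneg ?_ (by positivity)
    calc δ ^ (4 * k + 3) = (δ ^ (2 * k + 1)) ^ 2 * δ := by ring
      _ ≤ (C₂ * τ) ^ 2 * δ := by gcongr
      _ = C₂ ^ 2 * C₁ * ε := by
        rw [mul_pow, hτ]
        field_simp
  · have hδε : δ ≤ C₁ / σ₀ ^ 2 * ε := by
      have hσ₀τ : σ₀ ^ 2 ≤ C₁ * ε / δ := hτ ▸ pow_le_pow_left₀ hσ₀.le hle 2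
      rw [le_div_iff₀ hδ] at hσ₀τ
      rw [div_mul_eq_mul_div, le_div_iff₀' (by positivity)]
      exact hσ₀τ
    refine le_add_of_nonneg_of_le (by positivity) ?_
    calc δ ^ (4 * k + 3) = δ ^ (4 * k + 2) * δ := pow_succ _ _
      _ ≤ M ^ (4 * k + 2) * (C₁ / σ₀ ^ 2 * ε) := by gcongr
      _ = _ := by ring

/-- Local Hölder continuity with exponent `α` of the refractor map `x ↦ ∂u(x)`. As the map is
multivalued, this includes that it is single-valued when `α > 0`. -/
def SubdiffHolderLoc {n : ℕ} (κ α : ℝ) (Ω T : Set (Space n)) (u : Space n → ℝ) : Prop :=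
  ∀ K ⊆ Ω, IsCompact K → ∃ C ≥ 0, ∀ x ∈ K, ∀ y ∈ K, ∀ Y ∈ subdiff κ Ω T u x,
    ∀ Z ∈ subdiff κ Ω T u y, ‖Y - Z‖ ≤ C * ‖x - y‖ ^ α

variable {n : ℕ} {κ c₁ c₂ : ℝ} {Ω T : Set (Space n)} {E : Space n → Set (Space n)}
  {s : Space n → Space n → ℝ} {u : Space n → ℝ}

theorem HypA.exists_norm_target_sub_le (hA : HypA κ c₁ c₂ Ω T E s) (hc₁ : 0 < c₁)
    (hΩ : Ω ⊆ unitSphere n) :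
    ∃ M > 0, ∀ X ∈ Gam c₁ c₂ Ω, ∀ Y ∈ T, ∀ Y' ∈ T, ‖Y - Y'‖ ≤ M := by
  obtain ⟨M, hM, hle⟩ := hA.exists_norm_sub_le hc₁ hΩ
  refine ⟨M * 2, by positivity, fun X hX Y hY Y' hY' => (hle X hX Y hY Y' hY').trans ?_⟩
  gcongr
  exact hA.norm_dir_sub_dir_le_two hX hY hY'

/-- At scale `σ` the measure of the images of the points near `x̄` is bounded below by that of the
part of the target near the middle of the curve, and above by a multiple of `σ ^ (n - 1)`. -/
theorem IsRefractor.exists_pow_norm_sub_le_of_scale (hn : 2 ≤ n)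
    (hu : IsRefractor κ c₁ c₂ Ω T u) (hA : HypA κ c₁ c₂ Ω T E s) (hC : HypC κ c₁ c₂ Ω E s)
    (hD : HypD κ c₁ c₂ Ω T s) (hmeas : MeasureBound κ Ω T u) (hfar : IsFar κ c₁ c₂ Ω T)
    (hκ0 : 0 < κ) (hκ1 : κ < 1) (hc₁ : 0 < c₁) (hc₂ : 0 < c₂) (hΩ : Ω ⊆ unitSphere n) :
    ∃ C₁ > 0, ∃ C₂, ∃ R > 0, ∃ d > 0, ∀ xbar ∈ Ω, ∀ xhat ∈ Ω, ∀ Ybar ∈ subdiff κ Ω T u xbar,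
      ∀ Yhat ∈ subdiff κ Ω T u xhat, ∀ σ > 0, C₁ * ‖xbar - xhat‖ ≤ σ ^ 2 * ‖Ybar - Yhat‖ →
      Metric.ball xbar (R * σ) ∩ unitSphere n ⊆ Ω → ‖Ybar - Yhat‖ ^ 2 * σ ≤ d →
      Ybar ≠ Yhat → ‖Ybar - Yhat‖ ^ (2 * (n - 2) + 1) ≤ C₂ * σ := by
  obtain ⟨k, rfl⟩ : ∃ k, n = k + 2 := ⟨n - 2, by omega⟩
  obtain ⟨C₁, hC₁, a, ha, R, hR, hsub⟩ :=
    hu.exists_thickening_subset hA hC hfar hκ0 hκ1 hc₁ hc₂ hΩ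
  obtain ⟨μ₀, hμ₀, C, hCpos, hlower⟩ := hD
  obtain ⟨C', hupper⟩ := hmeas
  refine ⟨C₁, hC₁, C' * R ^ (k + 1) / (C * a ^ k), R, hR, μ₀ / a, by positivity, ?_⟩
  intro xbar hxbar xhat hxhat Ybar hYbar Yhat hYhat σ hσ hscale hball hsmall hne
  have hδ : 0 < ‖Ybar - Yhat‖ := norm_sub_pos_iff.2 hne
  have hμ : a * ‖Ybar - Yhat‖ ^ 2 * σ ≤ μ₀ := by
    rwa [mul_assoc, ← le_div_iff₀' ha]
  have hmeasure := (hlower _ (hu.graphPt_mem hxbar) Ybar hYbar.1 Yhat hYhat.1 _ (by positivity)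
    hμ).trans ((MeasureTheory.measure_mono (hsub xbar hxbar xhat hxhat Ybar hYbar Yhat hYhat σ hσ
      hscale hball)).trans (hupper xbar (hΩ hxbar) (R * σ) (by positivity) hball))
  have hreal : C * (a * ‖Ybar - Yhat‖ ^ 2 * σ) ^ k * ‖Ybar - Yhat‖ ≤ C' * (R * σ) ^ (k + 1) :=
    (ENNReal.ofReal_le_ofReal_iff'.1 hmeasure).resolve_right (not_le.2 (by positivity))
  rw [div_mul_eq_mul_div, le_div_iff₀ (by positivity)]
  refine le_of_mul_le_mul_left ?_ (pow_pos hσ k)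
  calc _ = C * (a * ‖Ybar - Yhat‖ ^ 2 * σ) ^ k * ‖Ybar - Yhat‖ := by
        rw [Nat.add_sub_cancel]
        ring
    _ ≤ C' * (R * σ) ^ (k + 1) := hreal
    _ = _ := by ring

variable (hn : 2 ≤ n) (hu : IsRefractor κ c₁ c₂ Ω T u) (hA : HypA κ c₁ c₂ Ω T E s)
  (hC : HypC κ c₁ c₂ Ω E s) (hD : HypD κ c₁ c₂ Ω T s) (hmeas : MeasureBound κ Ω T u)
  (hfar : IsFar κ c₁ c₂ Ω T) (hκ0 : 0 < κ) (hκ1 : κ < 1) (hc₁ : 0 < c₁) (hc₂ : 0 < c₂)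
  (hΩ : ∃ U : Set (Space n), IsOpen U ∧ Ω = U ∩ unitSphere n)
include hn hu hA hC hD hmeas hfar hκ0 hκ1 hc₁ hc₂ hΩ

theorem IsRefractor.exists_pow_norm_sub_le {K : Set (Space n)} (hK : IsCompact K) (hKΩ : K ⊆ Ω) :
    ∃ B ≥ 0, ∀ xbar ∈ K, ∀ xhat ∈ K, ∀ Ybar ∈ subdiff κ Ω T u xbar,
      ∀ Yhat ∈ subdiff κ Ω T u xhat, ‖Ybar - Yhat‖ ^ (4 * (n - 2) + 3) ≤ B * ‖xbar - xhat‖ := by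
  obtain ⟨U, hU, rfl⟩ := hΩ
  obtain ⟨C₁, hC₁, C₂, R, hR, d, hd, hscale⟩ := hu.exists_pow_norm_sub_le_of_scale hn hA hC hD hmeas
    hfar hκ0 hκ1 hc₁ hc₂ Set.inter_subset_right
  obtain ⟨M, hM, hdiam⟩ := hA.exists_norm_target_sub_le hc₁ Set.inter_subset_right
  obtain ⟨r, hr, hrU⟩ := hK.exists_thickening_subset_open hU (hKΩ.trans Set.inter_subset_left)
  set σ₀ := min (r / R) (d / M ^ 2)
  have hσ₀ : 0 < σ₀ := by positivity
  refine ⟨C₂ ^ 2 * C₁ + M ^ (4 * (n - 2) + 2) * (C₁ / σ₀ ^ 2), by positivity, ?_⟩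
  intro xbar hxbar xhat hxhat Ybar hYbar Yhat hYhat
  rcases eq_or_ne Ybar Yhat with rfl | hne
  · rw [sub_self, norm_zero, zero_pow (by omega)]
    positivity
  have hδM := hdiam _ (hu.graphPt_mem (hKΩ hxbar)) Ybar hYbar.1 Yhat hYhat.1
  refine pow_le_of_scale (norm_sub_pos_iff.2 hne) hδM hC₁.le hσ₀ (norm_nonneg _)
    fun σ hσ hσσ₀ hσδ => hscale xbar (hKΩ hxbar) xhat (hKΩ hxhat) Ybar hYbar Yhat hYhat σ hσ hσδ
      (Set.inter_subset_inter_left _ ?_) ?_ hne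
  · have hσr : R * σ ≤ r := (le_div_iff₀' hR).1 (hσσ₀.trans (min_le_left _ _))
    exact (Metric.ball_subset_ball hσr).trans ((Metric.ball_subset_thickening hxbar r).trans hrU)
  · calc ‖Ybar - Yhat‖ ^ 2 * σ ≤ M ^ 2 * σ := by gcongr
      _ ≤ d := (le_div_iff₀' (by positivity)).1 (hσσ₀.trans (min_le_right _ _))

theorem IsRefractor.subdiffHolderLoc : SubdiffHolderLoc κ (1 / (4 * (n : ℝ) - 5)) Ω T u := by
  intro K hKΩ hK
  obtain ⟨B, hB, hle⟩ :=
    hu.exists_pow_norm_sub_le hn hA hC hD hmeas hfar hκ0 hκ1 hc₁ hc₂ hΩ hK hKΩ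
  have hcast : ((4 * (n - 2) + 3 : ℕ) : ℝ) = 4 * (n : ℝ) - 5 := by
    push_cast [Nat.cast_sub hn]
    ring
  rw [← hcast, one_div]
  refine ⟨B ^ ((4 * (n - 2) + 3 : ℕ) : ℝ)⁻¹, by positivity, fun x hx y hy Y hY Z hZ => ?_⟩
  rw [← Real.mul_rpow hB (norm_nonneg _),
    ← Real.pow_rpow_inv_natCast (norm_nonneg (Y - Z)) (show 4 * (n - 2) + 3 ≠ 0 by omega)]
  exact Real.rpow_le_rpow (by positivity) (hle x hx y hy Y hY Z hZ) (by positivity)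

end HolderSubdiff

section ObliquityGeometry

variable {V : Type*} [NormedAddCommGroup V] [InnerProductSpace ℝ V] {κ : ℝ} {x x' : V}

/-- The factor `|Z| - κ Z · x`, which vanishes only if the ray in direction `x` is tangent to the
oval whose focus is seen along `Z`. -/
def obliquity (κ : ℝ) (x Z : V) : ℝ := ‖Z‖ - κ * ⟪Z, x⟫

theorem le_obliquity (hκ0 : 0 ≤ κ) (hx : ‖x‖ = 1) (Z : V) : (1 - κ) * ‖Z‖ ≤ obliquity κ x Z := by
  have hinner := real_inner_le_norm Z x
  rw [hx, mul_one] at hinner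
  unfold obliquity
  linarith [mul_le_mul_of_nonneg_left hinner hκ0]

theorem obliquity_sub_smul (hx : ‖x‖ = 1) (κ ρ : ℝ) (Y : V) :
    obliquity κ x (Y - ρ • x) = ‖Y - ρ • x‖ - κ * (⟪x, Y⟫ - ρ) := by
  rw [obliquity, inner_sub_left, real_inner_smul_left, real_inner_self_eq_norm_sq, hx,
    real_inner_comm, one_pow, mul_one]

theorem discrim_eq_obliquity_sq (hx : ‖x‖ = 1) (κ ρ : ℝ) (Y : V) :
    (ρ + κ * ‖Y - ρ • x‖ - κ ^ 2 * ⟪x, Y⟫) ^ 2 -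
        (1 - κ ^ 2) * ((ρ + κ * ‖Y - ρ • x‖) ^ 2 - κ ^ 2 * ‖Y‖ ^ 2) =
      (κ * obliquity κ x (Y - ρ • x)) ^ 2 := by
  have hsq : ‖Y - ρ • x‖ ^ 2 = ‖Y‖ ^ 2 - 2 * ρ * ⟪x, Y⟫ + ρ ^ 2 := by
    rw [norm_sub_sq_real, real_inner_smul_right, norm_smul, hx, mul_one, Real.norm_eq_abs, sq_abs,
      real_inner_comm]
    ring
  rw [obliquity_sub_smul hx]
  linear_combination (-(κ ^ 2 * (1 - κ ^ 2))) * hsq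

theorem abs_inner_sub_inner_le (hx : ‖x‖ = 1) (Z Z' : V) :
    |⟪Z, x⟫ - ⟪Z', x'⟫| ≤ ‖Z - Z'‖ + ‖Z'‖ * ‖x - x'‖ :=
  calc |⟪Z, x⟫ - ⟪Z', x'⟫| = |⟪Z - Z', x⟫ + ⟪Z', x - x'⟫| := by
        rw [inner_sub_left, inner_sub_right, sub_add_sub_cancel]
    _ ≤ ‖Z - Z'‖ + ‖Z'‖ * ‖x - x'‖ := by
        grw [abs_add_le, abs_real_inner_le_norm, abs_real_inner_le_norm, hx, mul_one]

theorem abs_obliquity_sub_le (hκ0 : 0 ≤ κ) (hκ1 : κ ≤ 1) (hx : ‖x‖ = 1) (Z Z' : V) :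
    |obliquity κ x Z - obliquity κ x' Z'| ≤ 2 * ‖Z - Z'‖ + ‖Z'‖ * ‖x - x'‖ :=
  calc |obliquity κ x Z - obliquity κ x' Z'|
      = |(‖Z‖ - ‖Z'‖) - κ * (⟪Z, x⟫ - ⟪Z', x'⟫)| := by
        unfold obliquity
        congr 1
        ring
    _ ≤ ‖Z - Z'‖ + 1 * (‖Z - Z'‖ + ‖Z'‖ * ‖x - x'‖) := by
        grw [abs_sub, abs_norm_sub_norm_le, abs_mul, abs_of_nonneg hκ0, hκ1,
          abs_inner_sub_inner_le hx]
    _ = 2 * ‖Z - Z'‖ + ‖Z'‖ * ‖x - x'‖ := by ring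

theorem norm_tangential_sub_le (hx : ‖x‖ = 1) (hx' : ‖x'‖ = 1) (Z Z' : V) :
    ‖(Z - ⟪Z, x⟫ • x) - (Z' - ⟪Z', x'⟫ • x')‖ ≤ 2 * (‖Z - Z'‖ + ‖Z'‖ * ‖x - x'‖) :=
  calc ‖(Z - ⟪Z, x⟫ • x) - (Z' - ⟪Z', x'⟫ • x')‖
      = ‖(Z - Z') - ((⟪Z, x⟫ - ⟪Z', x'⟫) • x + ⟪Z', x'⟫ • (x - x'))‖ := by
        congr 1
        module
    _ ≤ ‖Z - Z'‖ + ((‖Z - Z'‖ + ‖Z'‖ * ‖x - x'‖) + ‖Z'‖ * ‖x - x'‖) := by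
        grw [norm_sub_le, norm_add_le, norm_smul, norm_smul, Real.norm_eq_abs, Real.norm_eq_abs,
          abs_inner_sub_inner_le hx, abs_real_inner_le_norm, hx, hx', mul_one, mul_one]
    _ = 2 * (‖Z - Z'‖ + ‖Z'‖ * ‖x - x'‖) := by ring

theorem abs_div_sub_div_le {q₀ q q' : ℝ} (hq₀ : 0 < q₀) (hq : q₀ ≤ q) (hq' : q₀ ≤ q') (a a' : ℝ) :
    |a / q - a' / q'| ≤ |a - a'| / q₀ + |a'| * |q - q'| / q₀ ^ 2 := by
  have hqpos := hq₀.trans_le hq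
  have hqpos' := hq₀.trans_le hq'
  calc |a / q - a' / q'| = |(a - a') / q - a' * (q - q') / (q * q')| := by
        congr 1
        field_simp
        ring
    _ ≤ |a - a'| / q + |a'| * |q - q'| / (q * q') := by
        grw [abs_sub, abs_div, abs_div, abs_mul, abs_of_pos hqpos,
          abs_of_pos (mul_pos hqpos hqpos')]
    _ ≤ _ := by
        rw [sq]
        gcongr

/-- The tangential gradient at `x` of the polar radius of an oval through `ρ x` whose focus is
`ρ x + Z`. -/
def ovalTangent (κ ρ : ℝ) (x Z : V) : V := (κ * ρ / obliquity κ x Z) • (Z - ⟪Z, x⟫ • x)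

theorem tangential_smul_eq_ovalTangent (hx : ‖x‖ = 1) (κ ρ : ℝ) (Y : V) :
    (κ * ρ / obliquity κ x (Y - ρ • x)) • Y -
        ⟪(κ * ρ / obliquity κ x (Y - ρ • x)) • Y, x⟫ • x =
      ovalTangent κ ρ x (Y - ρ • x) := by
  rw [ovalTangent, real_inner_smul_left, inner_sub_left, real_inner_smul_left,
    real_inner_self_eq_norm_sq, hx]
  module

theorem exists_norm_ovalTangent_sub_le (V : Type*) [NormedAddCommGroup V] [InnerProductSpace ℝ V]
    {κ c S q₀ : ℝ} (hκ0 : 0 ≤ κ) (hκ1 : κ ≤ 1) (hc : 0 ≤ c) (hS : 0 ≤ S) (hq₀ : 0 < q₀) :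
    ∃ C ≥ 0, ∀ (x x' Z Z' : V) (ρ ρ' η : ℝ), ‖x‖ = 1 → ‖x'‖ = 1 → ‖Z‖ ≤ S → ‖Z'‖ ≤ S → |ρ'| ≤ c →
      q₀ ≤ obliquity κ x Z → q₀ ≤ obliquity κ x' Z' →
      ‖x - x'‖ ≤ η → ‖Z - Z'‖ ≤ η → |ρ - ρ'| ≤ η →
      ‖ovalTangent κ ρ x Z - ovalTangent κ ρ' x' Z'‖ ≤ C * η := by
  refine ⟨(1 / q₀ + c * (2 + S) / q₀ ^ 2) * (2 * S) + c / q₀ * (2 * (1 + S)), by positivity, ?_⟩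
  intro x x' Z Z' ρ ρ' η hx hx' hZ hZ' hρ' hq hq' hxη hZη hρη
  have hη : 0 ≤ η := (norm_nonneg _).trans hxη
  have hq'pos : 0 < obliquity κ x' Z' := hq₀.trans_le hq'
  set P := Z - ⟪Z, x⟫ • x
  set P' := Z' - ⟪Z', x'⟫ • x'
  have hP : ‖P‖ ≤ 2 * S := by
    have hle := norm_tangential_sub_le hx hx Z 0
    simp only [inner_zero_left, zero_smul, sub_zero, norm_zero, zero_mul, add_zero] at hle
    grw [hle, hZ]
  have hκρ : |κ * ρ'| ≤ c := by grw [abs_mul, abs_of_nonneg hκ0, hκ1, hρ', one_mul]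
  have hcoeff : |κ * ρ / obliquity κ x Z - κ * ρ' / obliquity κ x' Z'| ≤
      η / q₀ + c * (2 * η + S * η) / q₀ ^ 2 := by
    have hκη : |κ * ρ - κ * ρ'| ≤ η := by
      grw [← mul_sub, abs_mul, abs_of_nonneg hκ0, hκ1, hρη, one_mul]
    grw [abs_div_sub_div_le hq₀ hq hq', hκη, hκρ, abs_obliquity_sub_le hκ0 hκ1 hx, hZη, hZ', hxη]
  have hcoeff' : |κ * ρ' / obliquity κ x' Z'| ≤ c / q₀ := by
    grw [abs_div, abs_of_pos hq'pos, hκρ, ← hq']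
  calc ‖ovalTangent κ ρ x Z - ovalTangent κ ρ' x' Z'‖
      = ‖(κ * ρ / obliquity κ x Z - κ * ρ' / obliquity κ x' Z') • P +
          (κ * ρ' / obliquity κ x' Z') • (P - P')‖ := by
        simp only [ovalTangent, P, P']
        congr 1
        module
    _ ≤ (η / q₀ + c * (2 * η + S * η) / q₀ ^ 2) * (2 * S) + c / q₀ * (2 * (η + S * η)) := by
        grw [norm_add_le, norm_smul, norm_smul, Real.norm_eq_abs, Real.norm_eq_abs, hcoeff, hcoeff',
          hP, norm_tangential_sub_le hx hx', hZη, hZ', hxη]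
    _ = _ := by ring

end ObliquityGeometry

section Differentiability

theorem hasDerivAt_smaller_root {B d : ℝ} (hdisc : B ^ 2 - d ≠ 0) (e : ℝ) :
    HasDerivAt (fun t : ℝ => (t - √(t ^ 2 - d)) / e) ((1 - B / √(B ^ 2 - d)) / e) B := by
  have hsqrt := ((hasDerivAt_pow 2 B).sub_const d).sqrt hdisc
  refine (((hasDerivAt_id B).sub hsqrt).div_const e).congr_deriv ?_
  congr 2
  rw [pow_one, Nat.cast_ofNat, mul_div_mul_left _ _ two_ne_zero]

variable {n : ℕ} {κ : ℝ}

theorem hasGradientAt_h (hκ0 : 0 < κ) (hκ1 : κ < 1) {x₀ Y : Space n} {ρ : ℝ} (hx₀ : ‖x₀‖ = 1)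
    (hρ : 0 ≤ ρ) (hY : 0 < ‖Y - ρ • x₀‖) :
    HasGradientAt (fun x => h κ x Y (ρ • x₀)) ((κ * ρ / obliquity κ x₀ (Y - ρ • x₀)) • Y) x₀ := by
  have hκ : 1 - κ ^ 2 ≠ 0 := (sub_pos.2 (pow_lt_one₀ hκ0.le hκ1 two_ne_zero)).ne'
  have hdisc := discrim_eq_obliquity_sq hx₀ κ ρ Y
  have hB : ρ + κ * ‖Y - ρ • x₀‖ - κ ^ 2 * ⟪x₀, Y⟫ =
      κ * obliquity κ x₀ (Y - ρ • x₀) + (1 - κ ^ 2) * ρ := by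
    rw [obliquity_sub_smul hx₀]
    ring
  set q := obliquity κ x₀ (Y - ρ • x₀)
  set b := ρ + κ * ‖Y - ρ • x₀‖
  have hq : 0 < q := (mul_pos (sub_pos.2 hκ1) hY).trans_le (le_obliquity hκ0.le hx₀ _)
  have hinner :
      HasFDerivAt (fun x : Space n => b - κ ^ 2 * ⟪x, Y⟫) (-(κ ^ 2 • innerSL ℝ Y)) x₀ := by
    have hlin : HasFDerivAt (fun x : Space n => ⟪x, Y⟫) (innerSL ℝ Y) x₀ :=
      (innerSL ℝ Y).hasFDerivAt.congr_of_eventuallyEq (.of_forall fun x => real_inner_comm Y x)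
    exact (hlin.const_mul (κ ^ 2)).const_sub b
  have hdisc0 : (b - κ ^ 2 * ⟪x₀, Y⟫) ^ 2 - (1 - κ ^ 2) * (b ^ 2 - κ ^ 2 * ‖Y‖ ^ 2) ≠ 0 := by
    rw [hdisc]
    positivity
  have hroot := hasDerivAt_smaller_root hdisc0 (1 - κ ^ 2)
  rw [hasGradientAt_iff_hasFDerivAt]
  have hcomp := hroot.comp_hasFDerivAt x₀ hinner
  rw [hdisc, Real.sqrt_sq (by positivity), hB] at hcomp
  have hb : ‖ρ • x₀‖ + κ * ‖ρ • x₀ - Y‖ = b := by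
    rw [norm_sub_rev, norm_smul, hx₀, mul_one, Real.norm_of_nonneg hρ]
  refine (hcomp.congr_of_eventuallyEq (.of_forall fun x => ?_)).congr_fderiv ?_
  · simp only [h, ovalRadius, hb, Function.comp_apply]
  · ext v
    simp
    field_simp
    ring

theorem hasFDerivAt_dir {x₀ : Space n} (hx₀ : ‖x₀‖ = 1) :
    HasFDerivAt (dir : Space n → Space n)
      (ContinuousLinearMap.id ℝ (Space n) - (innerSL ℝ x₀).smulRight x₀) x₀ := by
  have hsqrt : HasDerivAt (fun r : ℝ => (√r)⁻¹) (-(1 / 2)) (‖x₀‖ ^ 2) := by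
    rw [hx₀, one_pow]
    refine (((hasDerivAt_id (1 : ℝ)).sqrt one_ne_zero).inv (by simp)).congr_deriv ?_
    simp
  have hnorm : HasFDerivAt (fun y : Space n => ‖y‖⁻¹) (-(innerSL ℝ x₀)) x₀ := by
    refine ((hsqrt.comp_hasFDerivAt x₀ (hasStrictFDerivAt_norm_sq x₀).hasFDerivAt)
      |>.congr_of_eventuallyEq (.of_forall fun y => ?_)).congr_fderiv ?_
    · simp only [Function.comp_apply, Real.sqrt_sq (norm_nonneg y)]
    · ext v
      simp
  refine (hnorm.smul (hasFDerivAt_id x₀)).congr_fderiv ?_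
  ext v
  simp [hx₀, sub_eq_add_neg]

theorem hasGradientAt_comp_dir {k : Space n → ℝ} {g x₀ : Space n} (hx₀ : ‖x₀‖ = 1)
    (hk : HasGradientAt k g x₀) :
    HasGradientAt (fun y => k (dir y)) (g - ⟪g, x₀⟫ • x₀) x₀ := by
  rw [hasGradientAt_iff_hasFDerivAt] at hk ⊢
  rw [← dir_eq_self hx₀] at hk
  refine (hk.comp x₀ (hasFDerivAt_dir hx₀)).congr_fderiv ?_
  ext v
  simp
  ring

theorem hasGradientAt_of_abs_sub_le {F : Type*} [NormedAddCommGroup F] [InnerProductSpace ℝ F]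
    [CompleteSpace F] {f k : F → ℝ} {g x₀ : F} {C α : ℝ} (hα : 0 < α) (hk : HasGradientAt k g x₀)
    (hfk : ∀ᶠ y in nhds x₀, |f y - k y| ≤ C * (‖y - x₀‖ * ‖y - x₀‖ ^ α)) :
    HasGradientAt f g x₀ := by
  rw [hasGradientAt_iff_isLittleO] at hk ⊢
  have hx₀ : f x₀ = k x₀ := by
    have hle := hfk.self_of_nhds
    rw [sub_self, norm_zero, zero_mul, mul_zero] at hle
    exact sub_eq_zero.1 (abs_nonpos_iff.1 hle)
  have hbound : (fun y => f y - k y) =O[nhds x₀] fun y => ‖y - x₀‖ * ‖y - x₀‖ ^ α := by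
    refine .of_bound C (hfk.mono fun y hy => ?_)
    rwa [Real.norm_eq_abs, Real.norm_of_nonneg (by positivity)]
  have hpow : (fun y : F => ‖y - x₀‖ ^ α) =o[nhds x₀] fun _ => (1 : ℝ) := by
    rw [Asymptotics.isLittleO_one_iff]
    have hcont : ContinuousAt (fun y : F => ‖y - x₀‖ ^ α) x₀ :=
      .rpow_const (by fun_prop) (Or.inr hα.le)
    simpa [Real.zero_rpow hα.ne'] using hcont.tendsto
  have hsmall : (fun y => f y - k y) =o[nhds x₀] fun y => y - x₀ := by
    simpa using hbound.trans_isLittleO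
      ((Asymptotics.isBigO_refl (fun y : F => ‖y - x₀‖) (nhds x₀)).mul_isLittleO hpow)
  refine (hsmall.add hk).congr_left fun y => ?_
  rw [hx₀]
  ring

end Differentiability

section RefractorGradient

variable {n : ℕ} {κ c₁ c₂ α : ℝ} {Ω T : Set (Space n)} {E : Space n → Set (Space n)}
  {s : Space n → Space n → ℝ} {u : Space n → ℝ}

theorem subset_unitSphere (hΩ : ∃ U : Set (Space n), IsOpen U ∧ Ω = U ∩ unitSphere n) :
    Ω ⊆ unitSphere n := by
  obtain ⟨U, -, rfl⟩ := hΩ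
  exact Set.inter_subset_right

theorem SubdiffHolderLoc.subsingleton (hhol : SubdiffHolderLoc κ α Ω T u) (hα : α ≠ 0)
    {x₀ : Space n} (hx₀ : x₀ ∈ Ω) : (subdiff κ Ω T u x₀).Subsingleton := by
  intro Y hY Z hZ
  obtain ⟨C, -, hle⟩ := hhol {x₀} (Set.singleton_subset_iff.2 hx₀) isCompact_singleton
  have hdist := hle x₀ rfl x₀ rfl Y hY Z hZ
  rw [sub_self, norm_zero, Real.zero_rpow hα, mul_zero] at hdist
  exact sub_eq_zero.1 (norm_le_zero_iff.1 hdist)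

theorem norm_dir_sub_le {x₀ : Space n} (hx₀ : ‖x₀‖ = 1) (y : Space n) :
    ‖dir y - x₀‖ ≤ 2 * ‖y - x₀‖ := by
  have hdir := norm_dir_sub_dir_le (norm_ne_zero_iff.1 (hx₀ ▸ one_ne_zero)) y
  rwa [dir_eq_self hx₀, hx₀, div_one, norm_sub_rev, norm_sub_rev x₀] at hdir

theorem exists_compact_eventually_dir_mem
    (hΩ : ∃ U : Set (Space n), IsOpen U ∧ Ω = U ∩ unitSphere n) {x₀ : Space n} (hx₀ : x₀ ∈ Ω) :
    ∃ K ⊆ Ω, IsCompact K ∧ x₀ ∈ K ∧ ∀ᶠ y in nhds x₀, dir y ∈ K := by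
  obtain ⟨U, hU, rfl⟩ := hΩ
  have hx₀1 : ‖x₀‖ = 1 := norm_of_mem Set.inter_subset_right hx₀
  obtain ⟨r, hr, hrU⟩ := Metric.nhds_basis_closedBall.mem_iff.1 (hU.mem_nhds hx₀.1)
  refine ⟨Metric.closedBall x₀ r ∩ unitSphere n, Set.inter_subset_inter_left _ hrU,
    (isCompact_closedBall _ _).inter_right Metric.isClosed_sphere,
    ⟨Metric.mem_closedBall_self hr.le, hx₀.2⟩, ?_⟩
  have hx₀0 : x₀ ≠ 0 := norm_ne_zero_iff.1 (hx₀1 ▸ one_ne_zero)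
  filter_upwards [isOpen_ne.mem_nhds hx₀0, Metric.closedBall_mem_nhds x₀ (half_pos hr)]
    with y hy0 hy
  refine ⟨?_, mem_sphere_zero_iff_norm.2 (norm_dir hy0)⟩
  rw [mem_closedBall_iff_norm] at hy ⊢
  linarith [norm_dir_sub_le hx₀1 y]

theorem le_two_mul_rpow {d : ℝ} (hd : 0 ≤ d) (hd2 : d ≤ 2) (hα0 : 0 ≤ α) (hα1 : α ≤ 1) :
    d ≤ 2 * d ^ α := by
  have hpow : d / 2 ≤ (d / 2) ^ α := by
    simpa only [Real.rpow_one] using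
      Real.rpow_le_rpow_of_exponent_ge' (by positivity) (by linarith) hα0 hα1
  linarith [Real.rpow_le_rpow (by positivity) (half_le_self hd) hα0]

variable (hu : IsRefractor κ c₁ c₂ Ω T u) (hfar : IsFar κ c₁ c₂ Ω T) (hκ0 : 0 < κ) (hκ1 : κ < 1)
  (hc₁ : 0 < c₁) (hc₂ : 0 < c₂)
include hu hfar hκ0 hκ1 hc₁ hc₂

/-- The oval supporting at `x₀` deviates from the refractor at `x` only as far as the targets of
`x₀` and `x` differ. -/
theorem IsRefractor.abs_sub_h_le (hΩ : Ω ⊆ unitSphere n) {x₀ x Y Z : Space n} (hx₀ : x₀ ∈ Ω)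
    (hx : x ∈ Ω) (hY : Y ∈ subdiff κ Ω T u x₀) (hZ : Z ∈ subdiff κ Ω T u x) :
    |u x - h κ x Y (graphPt u x₀)| ≤ 2 * κ ^ 2 / (1 - κ) ^ 2 * (‖x - x₀‖ * ‖Y - Z‖) := by
  have hκ : 0 < 1 - κ := sub_pos.2 hκ1
  have hx1 := norm_of_mem hΩ hx
  have hsupport : h κ x Y (graphPt u x₀) ≤ u x := hY.2 x hx
  have hmin := ((hu.mem_subdiff_iff hc₁ hΩ hκ0 hκ1).1 hZ).2 x₀ hx₀
  have hslope : (1 - κ) * (u x - h κ x Y (graphPt u x₀)) ≤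
      opticalLength κ Y (graphPt u x) - opticalLength κ Y (graphPt u x₀) := by
    have hray := slope_le_ray_sub hκ0.le hx1 Y hsupport
    rw [h, ovalRadius_spec hκ0.le hκ1 hx1] at hray
    rwa [opticalLength, opticalLength, hu.norm_graphPt hc₁ hΩ hx]
  have hmix := (abs_le.1 (hfar.abs_mixed_opticalLength_le hκ0 hc₂ (hu.graphPt_mem hx)
    (hu.graphPt_mem hx₀) hY.1 Z)).2
  rw [abs_of_nonneg (sub_nonneg.2 hsupport)]
  refine le_of_mul_le_mul_left ?_ hκ
  calc (1 - κ) * (u x - h κ x Y (graphPt u x₀))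
      ≤ 2 * κ ^ 2 / c₂ * ‖graphPt u x - graphPt u x₀‖ * ‖Y - Z‖ := by linarith
    _ ≤ 2 * κ ^ 2 / c₂ * (c₂ / (1 - κ) * ‖x - x₀‖) * ‖Y - Z‖ := by
        grw [hu.norm_graphPt_sub_le hc₁ hΩ hκ0 hκ1 hx hx₀]
    _ = _ := by field_simp

theorem IsRefractor.hasGradientAt_radialExt
    (hΩ : ∃ U : Set (Space n), IsOpen U ∧ Ω = U ∩ unitSphere n)
    (hhol : SubdiffHolderLoc κ α Ω T u) (hα : 0 < α) {x₀ Y g : Space n} (hx₀ : x₀ ∈ Ω)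
    (hY : Y ∈ subdiff κ Ω T u x₀) (hg : HasGradientAt (fun x => h κ x Y (graphPt u x₀)) g x₀) :
    HasGradientAt (radialExt u) (g - ⟪g, x₀⟫ • x₀) x₀ := by
  obtain ⟨K, hKΩ, hK, hx₀K, hnear⟩ := exists_compact_eventually_dir_mem hΩ hx₀
  obtain ⟨C, hC, hle⟩ := hhol K hKΩ hK
  have hΩs := subset_unitSphere hΩ
  have hx₀1 := norm_of_mem hΩs hx₀
  refine hasGradientAt_of_abs_sub_le (C := 2 * κ ^ 2 / (1 - κ) ^ 2 * (2 * (C * 2 ^ α))) hα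
    (hasGradientAt_comp_dir hx₀1 hg) ?_
  filter_upwards [hnear] with y hy
  obtain ⟨Z, hZ⟩ := hu.2 _ (hKΩ hy)
  have hYZ : ‖Y - Z‖ ≤ C * (2 ^ α * ‖y - x₀‖ ^ α) := by
    grw [hle x₀ hx₀K _ hy Y hY Z hZ, norm_sub_rev, norm_dir_sub_le hx₀1,
      Real.mul_rpow two_pos.le (norm_nonneg _)]
  calc _ ≤ 2 * κ ^ 2 / (1 - κ) ^ 2 * (‖dir y - x₀‖ * ‖Y - Z‖) :=
        hu.abs_sub_h_le hfar hκ0 hκ1 hc₁ hc₂ hΩs hx₀ (hKΩ hy) hY hZ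
    _ ≤ 2 * κ ^ 2 / (1 - κ) ^ 2 * (2 * ‖y - x₀‖ * (C * (2 ^ α * ‖y - x₀‖ ^ α))) := by
        grw [norm_dir_sub_le hx₀1, hYZ]
    _ = _ := by ring

theorem IsRefractor.hasGradientAt_h (hΩ : Ω ⊆ unitSphere n) {x₀ Y : Space n} (hx₀ : x₀ ∈ Ω)
    (hY : Y ∈ subdiff κ Ω T u x₀) :
    HasGradientAt (fun x => h κ x Y (graphPt u x₀))
      ((κ * u x₀ / obliquity κ x₀ (Y - graphPt u x₀)) • Y) x₀ :=
  NearField.hasGradientAt_h hκ0 hκ1 (norm_of_mem hΩ hx₀) (hc₁.le.trans (hu.1 x₀ hx₀).1)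
    (pos_of_mul_pos_right (hc₂.trans_le (hfar _ (hu.graphPt_mem hx₀) Y hY.1)) hκ0.le)

theorem IsRefractor.hasGradientAt_radialExt_ovalTangent
    (hΩ : ∃ U : Set (Space n), IsOpen U ∧ Ω = U ∩ unitSphere n)
    (hhol : SubdiffHolderLoc κ α Ω T u) (hα : 0 < α) {x₀ Y : Space n} (hx₀ : x₀ ∈ Ω)
    (hY : Y ∈ subdiff κ Ω T u x₀) :
    HasGradientAt (radialExt u) (ovalTangent κ (u x₀) x₀ (Y - graphPt u x₀)) x₀ := by
  have hΩs := subset_unitSphere hΩ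
  rw [graphPt, ← tangential_smul_eq_ovalTangent (norm_of_mem hΩs hx₀)]
  exact hu.hasGradientAt_radialExt hfar hκ0 hκ1 hc₁ hc₂ hΩ hhol hα hx₀ hY
    (hu.hasGradientAt_h hfar hκ0 hκ1 hc₁ hc₂ hΩs hx₀ hY)

omit hc₁ hc₂ in
theorem IsRefractor.le_obliquity (hΩ : Ω ⊆ unitSphere n) {x Y : Space n} (hx : x ∈ Ω)
    (hY : Y ∈ T) : (1 - κ) * (c₂ / κ) ≤ obliquity κ x (Y - graphPt u x) := by
  have hκ : 0 < 1 - κ := sub_pos.2 hκ1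
  have hdist : c₂ / κ ≤ ‖Y - graphPt u x‖ :=
    (div_le_iff₀' hκ0).2 (hfar _ (hu.graphPt_mem hx) Y hY)
  grw [hdist, NearField.le_obliquity hκ0.le (norm_of_mem hΩ hx)]

theorem IsRefractor.exists_ovalTangent_sub_le (hA : HypA κ c₁ c₂ Ω T E s)
    (hΩ : Ω ⊆ unitSphere n) (hhol : SubdiffHolderLoc κ α Ω T u) (hα0 : 0 ≤ α) (hα1 : α ≤ 1)
    {K : Set (Space n)} (hKΩ : K ⊆ Ω) (hK : IsCompact K) :
    ∃ C : ℝ, ∀ x ∈ K, ∀ y ∈ K, ∀ Y ∈ subdiff κ Ω T u x, ∀ Z ∈ subdiff κ Ω T u y,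
      ‖ovalTangent κ (u x) x (Y - graphPt u x) - ovalTangent κ (u y) y (Z - graphPt u y)‖ ≤
        C * ‖x - y‖ ^ α := by
  have hκ : 0 < 1 - κ := sub_pos.2 hκ1
  obtain ⟨C, hC, hle⟩ := hhol K hKΩ hK
  obtain ⟨S, hS, hdist⟩ := hA.exists_dist_le hc₁ hΩ
  obtain ⟨Ct, -, htangent⟩ := exists_norm_ovalTangent_sub_le (Space n) (q₀ := (1 - κ) * (c₂ / κ))
    hκ0.le hκ1.le hc₂.le hS.le (by positivity)
  set L := c₂ / (1 - κ)
  have hL : 0 ≤ L := by positivity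
  refine ⟨Ct * (2 * (1 + L) + C), fun x hx y hy Y hY Z hZ => ?_⟩
  have hxΩ := hKΩ hx
  have hyΩ := hKΩ hy
  have hx1 := norm_of_mem hΩ hxΩ
  have hy1 := norm_of_mem hΩ hyΩ
  have hgraph := hu.norm_graphPt_sub_le hc₁ hΩ hκ0 hκ1 hxΩ hyΩ
  have hradius : |u x - u y| ≤ L * ‖x - y‖ := by
    grw [← hgraph, ← abs_norm_sub_norm_le, hu.norm_graphPt hc₁ hΩ hxΩ, hu.norm_graphPt hc₁ hΩ hyΩ]
  have hfocus : ‖(Y - graphPt u x) - (Z - graphPt u y)‖ ≤ C * ‖x - y‖ ^ α + L * ‖x - y‖ := by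
    rw [sub_sub_sub_comm]
    grw [norm_sub_le, hle x hx y hy Y hY Z hZ, hgraph]
  have hxy : ‖x - y‖ ≤ 2 * ‖x - y‖ ^ α := by
    refine le_two_mul_rpow (norm_nonneg _) ?_ hα0 hα1
    grw [norm_sub_le, hx1, hy1, one_add_one_eq_two]
  have hLxy : L * ‖x - y‖ ≤ L * (2 * ‖x - y‖ ^ α) := by gcongr
  have hnonneg : 0 ≤ ‖x - y‖ ∧ 0 ≤ L * ‖x - y‖ ∧ 0 ≤ C * ‖x - y‖ ^ α := by
    refine ⟨?_, ?_, ?_⟩ <;> positivity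
  rw [mul_assoc]
  have hu_abs : |u y| ≤ c₂ := abs_le.2 ⟨by linarith [(hu.1 y hyΩ).1], (hu.1 y hyΩ).2⟩
  exact htangent x y _ _ _ _ _ hx1 hy1 (hdist _ (hu.graphPt_mem hxΩ) Y hY.1)
    (hdist _ (hu.graphPt_mem hyΩ) Z hZ.1) hu_abs (hu.le_obliquity hfar hκ0 hκ1 hΩ hxΩ hY.1)
    (hu.le_obliquity hfar hκ0 hκ1 hΩ hyΩ hZ.1) (by linarith) (by linarith) (by linarith)

theorem IsRefractor.isC1HolderLoc (hA : HypA κ c₁ c₂ Ω T E s)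
    (hΩ : ∃ U : Set (Space n), IsOpen U ∧ Ω = U ∩ unitSphere n)
    (hhol : SubdiffHolderLoc κ α Ω T u) (hα0 : 0 < α) (hα1 : α ≤ 1) : IsC1HolderLoc α Ω u := by
  have hgrad {x Y : Space n} (hx : x ∈ Ω) (hY : Y ∈ subdiff κ Ω T u x) :=
    hu.hasGradientAt_radialExt_ovalTangent hfar hκ0 hκ1 hc₁ hc₂ hΩ hhol hα0 hx hY
  refine ⟨fun x hx => (hgrad hx (hu.2 x hx).some_mem).differentiableAt, fun K hKΩ hK => ?_⟩
  obtain ⟨C, hle⟩ := hu.exists_ovalTangent_sub_le hfar hκ0 hκ1 hc₁ hc₂ hA (subset_unitSphere hΩ)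
    hhol hα0.le hα1 hKΩ hK
  refine ⟨C, fun x hx y hy => ?_⟩
  obtain ⟨Y, hY⟩ := hu.2 x (hKΩ hx)
  obtain ⟨Z, hZ⟩ := hu.2 y (hKΩ hy)
  rw [(hgrad (hKΩ hx) hY).gradient, (hgrad (hKΩ hy) hZ).gradient]
  exact hle x hx y hy Y hY Z hZ

end RefractorGradient

end NearField

end

theorem theorem5p5_general (n : ℕ) (hn : 2 ≤ n) (κ c₁ c₂ : ℝ) (hκ0 : 0 < κ) (hκ1 : κ < 1)
    (hc₁ : 0 < c₁) (hc₂ : 0 < c₂)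
    (Ω T : Set (NearField.Space n))
    (hΩ : ∃ U : Set (NearField.Space n), IsOpen U ∧ Ω = U ∩ NearField.unitSphere n)
    (E : NearField.Space n → Set (NearField.Space n))
    (s : NearField.Space n → NearField.Space n → ℝ)
    (hA : NearField.HypA κ c₁ c₂ Ω T E s)
    (hfar : NearField.IsFar κ c₁ c₂ Ω T)
    (hC : NearField.HypC κ c₁ c₂ Ω E s)
    (hD : NearField.HypD κ c₁ c₂ Ω T s)
    (u : NearField.Space n → ℝ)
    (hu : NearField.IsRefractor κ c₁ c₂ Ω T u)
    (hmeas : NearField.MeasureBound κ Ω T u) :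
    NearField.IsC1HolderLoc (1 / (4 * (n : ℝ) - 5)) Ω u ∧
      ∀ x₀ ∈ Ω, ∃ Y : NearField.Space n,
        NearField.subdiff κ Ω T u x₀ = {Y} ∧
          ∃ g : NearField.Space n,
            HasGradientAt (fun x => NearField.h κ x Y (u x₀ • x₀)) g x₀ ∧
              HasGradientAt (NearField.radialExt u) (g - (inner ℝ g x₀) • x₀) x₀ := by
  have hdenom : 3 ≤ 4 * (n : ℝ) - 5 := by
    have : (2 : ℝ) ≤ n := mod_cast hn
    linarith
  have hα : 0 < 1 / (4 * (n : ℝ) - 5) := by positivity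
  have hα1 : 1 / (4 * (n : ℝ) - 5) ≤ 1 := div_le_one_of_le₀ (by linarith) (by linarith)
  have hhol := hu.subdiffHolderLoc hn hA hC hD hmeas hfar hκ0 hκ1 hc₁ hc₂ hΩ
  refine ⟨hu.isC1HolderLoc hfar hκ0 hκ1 hc₁ hc₂ hA hΩ hhol hα hα1, fun x₀ hx₀ => ?_⟩
  obtain ⟨Y, hY⟩ := hu.2 x₀ hx₀
  have hoval := hu.hasGradientAt_h hfar hκ0 hκ1 hc₁ hc₂ (NearField.subset_unitSphere hΩ) hx₀ hY
  exact ⟨Y, (hhol.subsingleton hα.ne' hx₀).eq_singleton_of_mem hY, _, hoval,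
    hu.hasGradientAt_radialExt hfar hκ0 hκ1 hc₁ hc₂ hΩ hhol hα hx₀ hY hoval⟩

theorem theorem5p5 (n : ℕ) (hn : 2 ≤ n) (κ c₁ c₂ : ℝ) (hκ0 : 0 < κ) (hκ1 : κ < 1)
    (hc₁ : 0 < c₁) (hc₂ : c₁ < c₂)
    (Ω T : Set (NearField.Space n))
    (hΩ : ∃ U : Set (NearField.Space n), IsOpen U ∧ Ω = U ∩ NearField.unitSphere n)
    (E : NearField.Space n → Set (NearField.Space n))
    (s : NearField.Space n → NearField.Space n → ℝ)
    (hA : NearField.HypA κ c₁ c₂ Ω T E s)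
    (hB : NearField.HypB κ c₁ c₂ Ω T)
    (hC : NearField.HypC κ c₁ c₂ Ω E s)
    (hD : NearField.HypD κ c₁ c₂ Ω T s)
    (u : NearField.Space n → ℝ)
    (hu : NearField.IsRefractor κ c₁ c₂ Ω T u)
    (hmeas : NearField.MeasureBound κ Ω T u) :
    NearField.IsC1HolderLoc (1 / (4 * (n : ℝ) - 5)) Ω u ∧
      ∀ x₀ ∈ Ω, ∃ Y : NearField.Space n,
        NearField.subdiff κ Ω T u x₀ = {Y} ∧
          ∃ g : NearField.Space n,
            HasGradientAt (fun x => NearField.h κ x Y (u x₀ • x₀)) g x₀ ∧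
              HasGradientAt (NearField.radialExt u) (g - (inner ℝ g x₀) • x₀) x₀ :=
  theorem5p5_general n hn κ c₁ c₂ hκ0 hκ1 hc₁ (hc₁.trans hc₂) Ω T hΩ E s hA
    (hB.isFar hA hκ0 hc₁ hc₂.le (NearField.subset_unitSphere hΩ)) hC hD u hu hmeas
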